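/- Let $\lambda_p,\bar n,\sigma,\gamma_d>0$, $\alpha>2$ and $c_m\in[0,1]$. Let $\Phi$ be a Thomas cluster process in $\mathbb{R}^2$: the cluster centers form a homogeneous Poisson point process $\Phi_p$ of intensity $\lambda_p$; each cluster has a Poisson number of devices with mean $\bar n$, displaced from their cluster center by i.i.d. vectors with density $f_Y(y)=\frac{1}{2\pi\sigma^2}e^{-\|y\|^2/(2\sigma^2)}$, independently of everything else; each device caches a given content $m$ independently with probability $c_m$; the fading coefficients of all links are i.i.d. $\mathcal{CN}(0,1)$ (Rayleigh fading) and independent of the devices. Consider the typical device of $\Phi$ (in the sense of the Palm distribution), placed at the origin; let $x_0\in\Phi_p$ be the center of its (representative) cluster, $\Phi_p^!=\Phi_p\setminus\{x_0\}$, and let $\Phi_{cm}$ be the set of the other devices of its cluster that cache $m$. If every device of every remote cluster transmits with power $\gamma_d$, the inter-cluster interference at the typical device is $$I=\sum_{x\in\Phi_p^!}\ \sum_{y}\gamma_d\,G_{y}\,\|x+y\|^{-\alpha},$$ where $x+y$ runs over the devices of the cluster centered at $x$, and $G_y$ is the squared modulus of the fading coefficient between that device and the typical device. Then $I<\infty$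 almost surely and, for every $t\ge 0$, $$\mathcal{L}_I(t)=\mathbb{E}\big[e^{-tI}\big]=\exp\Big(-2\pi\lambda_p\int_0^\infty\big(1-e^{-\bar n\,\zeta(v,t)}\big)\,v\,dv\Big),\qquad \zeta(v,t)=\int_0^\infty\frac{t\gamma_d}{u^\alpha+t\gamma_d}\,f_{U|V}(u|v)\,du,$$ with convergent integrals, where $f_{U|V}(u|v)=\mathrm{Rice}(u;v,\sigma)=\frac{u}{\sigma^2}e^{-(u^2+v^2)/(2\sigma^2)}I_0\!\big(\frac{uv}{\sigma^2}\big)$ and $I_0$ is the modified Bessel function of the first kind of order $0$. The same expression is, almost surely, the conditional Laplace transform $\mathbb{E}[e^{-tI}\mid x_0,\Phi_{cm}]$. In particular, for every $\theta>0$, almost surely when $\Phi_{cm}\neq\emptyset$, $\mathbb{E}\big[e^{-\theta I/(\gamma_d S)}\mid x_0,\Phi_{cm}\big]=\mathcal{L}_I\big(\tfrac{\theta}{\gamma_d S}\big)$, where $S=\sum_{z\in\Phi_{cm}}\|z\|^{-\alpha}$, with locations $z$ relative to the typical device. -/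

import Mathlib

open MeasureTheory ProbabilityTheory Set
open scoped ENNReal NNReal

noncomputable section

/-- The plane `ℝ²` with the Euclidean norm. -/
abbrev Plane : Type := EuclideanSpace ℝ (Fin 2)

/-- Number of points of the enumerated point process `X` that lie in `A`. -/
def pointCount {Ω : Type*} (X : ℕ → Ω → Plane) (A : Set Plane) (ω : Ω) : ℝ≥0∞ :=
  ∑' i, A.indicator (fun _ => (1 : ℝ≥0∞)) (X i ω)

/-- The points `X 0, X 1, …` form a Poisson point process with intensity measure `Λ`: the number of
points in a Borel set `A` with `Λ A < ∞` is Poisson with mean `Λ A`, and the numbers of points in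
pairwise disjoint such sets are independent. -/
structure IsPoissonPointProcess {Ω : Type*} [MeasurableSpace Ω] (P : Measure Ω)
    (X : ℕ → Ω → Plane) (Λ : Measure Plane) : Prop where
  measurable : ∀ i, Measurable (X i)
  law_count : ∀ A : Set Plane, MeasurableSet A → Λ A ≠ ∞ →
    P.map (pointCount X A) =
      (poissonMeasure (Λ A).toNNReal).map (fun n : ℕ => (n : ℝ≥0∞))
  indep_count : ∀ (n : ℕ) (A : Fin n → Set Plane), (∀ i, MeasurableSet (A i)) →
    (∀ i, Λ (A i) ≠ ∞) → Pairwise (fun i j => Disjoint (A i) (A j)) →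
    iIndepFun (fun i => pointCount X (A i)) P

/-- The isotropic centred Gaussian law on `ℝ²`, with density
`y ↦ (2πσ²)⁻¹ exp (-‖y‖² / (2σ²))`. -/
def planarGaussian (σ : ℝ) : Measure Plane :=
  volume.withDensity fun y =>
    ENNReal.ofReal (1 / (2 * Real.pi * σ ^ 2) * Real.exp (-‖y‖ ^ 2 / (2 * σ ^ 2)))

/-- The circularly symmetric complex Gaussian law `𝒞𝒩(0, 1)`: real and imaginary parts are
independent, centred, of variance `1/2`. Its modulus is Rayleigh distributed. -/
def complexGaussian : Measure ℂ :=
  ((gaussianReal 0 (1 / 2)).prod (gaussianReal 0 (1 / 2))).map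
    (fun p : ℝ × ℝ => (⟨p.1, p.2⟩ : ℂ))

/-- The random elements that describe a clustered network with an enumeration of the clusters and of
the devices in each cluster. Device `(i, j)` exists when `j < size i`. -/
structure ClusterNetwork (Ω : Type*) where
  /-- location of the `i`-th cluster center -/
  parent : ℕ → Ω → Plane
  /-- number of members of the `i`-th cluster -/
  size : ℕ → Ω → ℕ
  /-- displacement of the device `(i, j)` from its cluster center -/
  disp : ℕ × ℕ → Ω → Plane
  /-- whether the device `(i, j)` caches the content under consideration -/
  cached : ℕ × ℕ → Ω → Bool
  /-- complex fading coefficient of the channel from a transmitter (second component) to a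
  receiver (first component) -/
  fading : (ℕ × ℕ) × (ℕ × ℕ) → Ω → ℂ

namespace ClusterNetwork

variable {Ω : Type*}

/-- Location of the device `q`. -/
def loc (𝒩 : ClusterNetwork Ω) (q : ℕ × ℕ) (ω : Ω) : Plane :=
  𝒩.parent q.1 ω + 𝒩.disp q ω

/-- A Thomas cluster process with parent intensity `lam`, mean cluster size `nbar` and displacement
parameter `σ`, whose devices cache the content independently with probability `c`, with
independent Rayleigh fading on all links. -/
structure IsThomas [MeasurableSpace Ω] (𝒩 : ClusterNetwork Ω) (P : Measure Ω)
    (lam nbar : ℝ≥0) (σ c : ℝ) : Prop where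
  parents : IsPoissonPointProcess P 𝒩.parent (lam • (volume : Measure Plane))
  measurable_size : ∀ i, Measurable (𝒩.size i)
  measurable_disp : ∀ q, Measurable (𝒩.disp q)
  measurable_cached : ∀ q, Measurable (𝒩.cached q)
  measurable_fading : ∀ e, Measurable (𝒩.fading e)
  law_size : ∀ i, P.map (𝒩.size i) = poissonMeasure nbar
  law_disp : ∀ q, P.map (𝒩.disp q) = planarGaussian σ
  law_cached : ∀ q, P {ω | 𝒩.cached q ω = true} = ENNReal.ofReal c
  law_fading : ∀ e, P.map (𝒩.fading e) = complexGaussian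
  /- each of the four families of marks is independent -/
  iIndep_size : iIndepFun 𝒩.size P
  iIndep_disp : iIndepFun 𝒩.disp P
  iIndep_cached : iIndepFun 𝒩.cached P
  iIndep_fading : iIndepFun 𝒩.fading P
  /- the parent process and the four families of marks are mutually independent -/
  indep_parent : IndepFun (fun ω i => 𝒩.parent i ω)
    (fun ω => (fun i => 𝒩.size i ω, fun q => 𝒩.disp q ω, fun q => 𝒩.cached q ω,
      fun e => 𝒩.fading e ω)) P
  indep_size : IndepFun (fun ω i => 𝒩.size i ω)
    (fun ω => (fun q => 𝒩.disp q ω, fun q => 𝒩.cached q ω, fun e => 𝒩.fading e ω)) P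
  indep_disp : IndepFun (fun ω q => 𝒩.disp q ω)
    (fun ω => (fun q => 𝒩.cached q ω, fun e => 𝒩.fading e ω)) P
  indep_cached : IndepFun (fun ω q => 𝒩.cached q ω) (fun ω e => 𝒩.fading e ω) P

/-- The law of the network together with its typical device: the Palm probability
`(lam * nbar * |B|)⁻¹ 𝔼 ∑_{devices p located in B} 𝟙[(ω, p) ∈ ·]`
of the stationary process of devices, whose intensity is `lam * nbar`. An outcome is `(ω, p)`, where
`p = (i, j)` is the typical device and `i` is the representative cluster. -/
def typicalDevice [MeasurableSpace Ω] (𝒩 : ClusterNetwork Ω) (P : Measure Ω)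
    (lam nbar : ℝ≥0) (B : Set Plane) : Measure (Ω × (ℕ × ℕ)) :=
  ((lam : ℝ≥0∞) * nbar * volume B)⁻¹ •
    Measure.sum fun p : ℕ × ℕ =>
      (P.restrict {ω | p.2 < 𝒩.size p.1 ω ∧ 𝒩.loc p ω ∈ B}).map (fun ω => (ω, p))

/-- Center of the representative cluster, seen from the typical device. -/
def repCenter (𝒩 : ClusterNetwork Ω) (w : Ω × (ℕ × ℕ)) : Plane :=
  𝒩.parent w.2.1 w.1 - 𝒩.loc w.2 w.1

/-- The catering devices: the other members of the representative cluster that cache the content, as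
a counting measure, in coordinates with the typical device at the origin. -/
def catering (𝒩 : ClusterNetwork Ω) (w : Ω × (ℕ × ℕ)) : Measure Plane :=
  ∑ l ∈ Finset.range (𝒩.size w.2.1 w.1),
    if l ≠ w.2.2 ∧ 𝒩.cached (w.2.1, l) w.1 = true then
      Measure.dirac (𝒩.loc (w.2.1, l) w.1 - 𝒩.loc w.2 w.1)
    else 0

/-- The information carried by the transmitters of the representative cluster: the center of the
cluster and the catering devices, seen from the typical device. -/
@[reducible] def cateringInfo [MeasurableSpace Ω] (𝒩 : ClusterNetwork Ω) :
    MeasurableSpace (Ω × (ℕ × ℕ)) :=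
  MeasurableSpace.comap (fun w => (𝒩.repCenter w, 𝒩.catering w)) inferInstance

/-- Sum of the path losses `‖z‖ ^ (-α)` over the catering devices `z`. -/
def servingSum (𝒩 : ClusterNetwork Ω) (α : ℝ) (w : Ω × (ℕ × ℕ)) : ℝ :=
  (∫⁻ z, ENNReal.ofReal ‖z‖ ^ (-α) ∂(𝒩.catering w)).toReal

/-- Inter-cluster interference at the typical device `w.2` when all devices of all remote clusters
transmit with power `γ`, with path-loss exponent `α`. -/
def interference (𝒩 : ClusterNetwork Ω) (α γ : ℝ) (w : Ω × (ℕ × ℕ)) : ℝ≥0∞ :=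
  ∑' k : ℕ, if k = w.2.1 then 0 else
    ∑ l ∈ Finset.range (𝒩.size k w.1),
      ENNReal.ofReal (γ * ‖𝒩.fading (w.2, (k, l)) w.1‖ ^ 2) *
        ENNReal.ofReal ‖𝒩.loc (k, l) w.1 - 𝒩.loc w.2 w.1‖ ^ (-α)

end ClusterNetwork

/-- Modified Bessel function of the first kind of order zero. -/
def besselI0 (z : ℝ) : ℝ :=
  1 / Real.pi * ∫ φ in (0 : ℝ)..Real.pi, Real.exp (z * Real.cos φ)

/-- The Rician probability density `Rice(u; v, σ)` (for `u > 0`). -/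
def ricePDF (u v σ : ℝ) : ℝ :=
  u / σ ^ 2 * Real.exp (-(u ^ 2 + v ^ 2) / (2 * σ ^ 2)) * besselI0 (u * v / σ ^ 2)

/-- The function `ζ(v, t)`. -/
def zetaFn (α γ σ v t : ℝ) : ℝ :=
  ∫ u in Ioi (0 : ℝ), t * γ / (u ^ α + t * γ) * ricePDF u v σ

/-- The claimed Laplace transform at `t`. -/
def laplaceFormula (lam nbar : ℝ≥0) (α γ σ t : ℝ) : ℝ :=
  Real.exp (-2 * Real.pi * lam *
    ∫ v in Ioi (0 : ℝ), (1 - Real.exp (-nbar * zetaFn α γ σ v t)) * v)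

end

/-! The center and the catering devices, seen from the typical device, are a function of the marks
of the representative cluster alone, since the position of the center cancels (`info_eq`). It
therefore suffices to prove, under the Palm law, E[H e^{-τI}] = E[H L(τ)] for every weight H and
every argument τ computed from this information (`lintegral_mul_expNeg_interference`). Taking H to
be an indicator gives the conditional transform, and a nonconstant τ gives the random argument
θ/(γS).

Freeze the marks of the representative cluster and let d be the displacement of the typical device.
Given the centers, the remote clusters are independent. Rayleigh fading turns a device at z into the
factor 1 - tγ/(‖z‖^α + tγ), the Gaussian displacement averages this to 1 - `clusterLoss`, and the
Poisson size turns powers of it into exp(-n̄ `clusterLoss`) (`lintegral_expNeg_power`). What is left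
is a multiplicative functional of the other centers viewed from X_i + d. By Mecke's formula the
other centers seen from X_i are again Poisson, and translation invariance removes d
(`lintegral_parent`), so the constant `networkLaplace` factors out.

Mecke's formula is itself derived from the law of the counts: Laplace functional of simple
functions, monotone limits, differentiation in the direction of an indicator, cancellation of the
factor of the chosen point, and recentering by approximating X_i with simple functions.

Polar coordinates identify `clusterLoss` with the Rice integral ζ and `networkLaplace` with the
stated formula. Since α > 2 the attenuation is integrable over the plane; hence the integrals
converge, L(t) → 1 as t → 0, and I is almost surely finite. Transforms are computed in [0, ∞] with
e^{-∞} = 0, so finiteness of I matters only on return to real exponentials. -/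

open Filter Topology

/-! ### Extended exponential, Poisson generating function and difference quotients -/

/-- The decreasing exponential `x ↦ e⁻ˣ` on `[0, ∞]`, with value `0` at `∞`. -/
noncomputable def expNeg (x : ℝ≥0∞) : ℝ≥0∞ := EReal.exp (-(x : EReal))

@[simp] lemma expNeg_zero : expNeg 0 = 1 := by simp [expNeg]

@[simp] lemma expNeg_top : expNeg ∞ = 0 := by simp [expNeg]

lemma expNeg_coe (x : ℝ≥0) : expNeg x = ENNReal.ofReal (Real.exp (-x)) := by
  have : (-((x : ℝ≥0∞) : EReal)) = ((-(x : ℝ) : ℝ) : EReal) := by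
    rw [EReal.coe_neg]; rfl
  rw [expNeg, this, EReal.exp_coe]

lemma expNeg_eq {x : ℝ≥0∞} (hx : x ≠ ∞) : expNeg x = ENNReal.ofReal (Real.exp (-x.toReal)) := by
  lift x to ℝ≥0 using hx
  simpa using expNeg_coe x

lemma expNeg_ofReal {x : ℝ} (hx : 0 ≤ x) :
    expNeg (ENNReal.ofReal x) = ENNReal.ofReal (Real.exp (-x)) := by
  rw [expNeg_eq ENNReal.ofReal_ne_top, ENNReal.toReal_ofReal hx]

lemma antitone_expNeg : Antitone expNeg := fun _ _ h =>
  EReal.exp_monotone (EReal.neg_le_neg_iff.2 (EReal.coe_ennreal_le_coe_ennreal_iff.2 h))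

lemma expNeg_le_one (x : ℝ≥0∞) : expNeg x ≤ 1 :=
  (antitone_expNeg zero_le).trans_eq expNeg_zero

lemma expNeg_ne_top (x : ℝ≥0∞) : expNeg x ≠ ∞ := ((expNeg_le_one x).trans_lt ENNReal.one_lt_top).ne

lemma expNeg_ne_zero {x : ℝ≥0∞} (hx : x ≠ ∞) : expNeg x ≠ 0 := by
  rw [expNeg_eq hx]; simp [Real.exp_pos]

lemma continuous_expNeg : Continuous expNeg :=
  ENNReal.continuous_exp.comp (continuous_neg.comp continuous_coe_ennreal_ereal)

@[fun_prop] lemma measurable_expNeg : Measurable expNeg := continuous_expNeg.measurable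

lemma expNeg_add (x y : ℝ≥0∞) : expNeg (x + y) = expNeg x * expNeg y := by
  rw [expNeg, expNeg, expNeg, ← EReal.exp_add, EReal.coe_ennreal_add, EReal.neg_add]
  · rfl
  · left; exact EReal.coe_ennreal_ne_bot x
  · right; exact EReal.coe_ennreal_ne_bot y

lemma expNeg_sum {ι : Type*} (s : Finset ι) (f : ι → ℝ≥0∞) :
    expNeg (∑ i ∈ s, f i) = ∏ i ∈ s, expNeg (f i) := by
  classical
  induction s using Finset.induction_on with
  | empty => simp
  | insert a s ha ih => rw [Finset.sum_insert ha, Finset.prod_insert ha, expNeg_add, ih]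

lemma expNeg_nat_mul (n : ℕ) (x : ℝ≥0∞) : expNeg (n * x) = expNeg x ^ n := by
  induction n with
  | zero => simp
  | succ n ih => rw [Nat.cast_succ, add_mul, one_mul, expNeg_add, ih, pow_succ]

lemma one_sub_expNeg_le (x : ℝ≥0∞) : 1 - expNeg x ≤ x := by
  by_cases hx : x = ∞
  · simp [hx]
  rw [expNeg_eq hx, ← ENNReal.ofReal_one, ← ENNReal.ofReal_sub _ (Real.exp_pos _).le]
  refine ENNReal.ofReal_le_of_le_toReal ?_
  linarith [Real.add_one_le_exp (-x.toReal)]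

/-- Probability generating function of the Poisson law. -/
lemma lintegral_pow_poissonMeasure (r : ℝ≥0) {s : ℝ≥0∞} (hs : s ≤ 1) :
    ∫⁻ n, s ^ n ∂(poissonMeasure r) = expNeg (r * (1 - s)) := by
  lift s to ℝ≥0 using (hs.trans_lt ENNReal.one_lt_top).ne
  have hs' : s ≤ 1 := by exact_mod_cast hs
  rw [lintegral_countable']
  have h1 : ∀ n : ℕ, (s : ℝ≥0∞) ^ n * poissonMeasure r {n} =
      ENNReal.ofReal (Real.exp (-r) * ((r * s : ℝ) ^ n / n.factorial)) := by
    intro n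
    rw [poissonMeasure_singleton, ← ENNReal.coe_pow, ← ENNReal.ofReal_coe_nnreal,
      ← ENNReal.ofReal_mul (by positivity)]
    congr 1
    push_cast
    rw [mul_pow]; ring
  have h2 := (NormedSpace.expSeries_div_hasSum_exp (r * s : ℝ)).mul_left (Real.exp (-r))
  simp_rw [h1]
  rw [← ENNReal.ofReal_tsum_of_nonneg (fun n => by positivity) h2.summable, h2.tsum_eq,
    ← Real.exp_eq_exp_ℝ, ← Real.exp_add]
  have h3 : (r : ℝ≥0∞) * (1 - s) = ((r * (1 - s) : ℝ≥0) : ℝ≥0∞) := by push_cast; rfl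
  rw [h3, expNeg_coe]
  congr 2
  push_cast [NNReal.coe_sub hs']
  ring

lemma lintegral_natCast_poissonMeasure (r : ℝ≥0) :
    ∫⁻ n, (n : ℝ≥0∞) ∂(poissonMeasure r) = r := by
  rw [lintegral_countable', tsum_eq_zero_add' ENNReal.summable]
  have h1 : ∀ n : ℕ, ((n + 1 : ℕ) : ℝ≥0∞) * poissonMeasure r {n + 1} =
      r * poissonMeasure r {n} := by
    intro n
    rw [poissonMeasure_singleton, poissonMeasure_singleton, ← ENNReal.ofReal_natCast,
      ← ENNReal.ofReal_coe_nnreal, ← ENNReal.ofReal_mul (by positivity),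
      ← ENNReal.ofReal_mul (by positivity)]
    congr 1
    rw [Nat.factorial_succ]
    push_cast
    field_simp
    ring
  simp_rw [h1, ENNReal.tsum_mul_left]
  have := lintegral_countable' (μ := poissonMeasure r) (fun _ : ℕ => (1 : ℝ≥0∞))
  simp only [lintegral_one, measure_univ, one_mul] at this
  simp [← this]

lemma tendsto_nat_mul_of_hasDerivAt {g : ℝ → ℝ} {x : ℝ} (hg : HasDerivAt g x 0) (h0 : g 0 = 0) :
    Tendsto (fun n : ℕ => (n + 1 : ℝ) * g (1 / (n + 1))) atTop (𝓝 x) := by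
  have h1 := hg.tendsto_slope_zero_right
  have h2 : Tendsto (fun n : ℕ => 1 / (n + 1 : ℝ)) atTop (𝓝[>] 0) := by
    refine tendsto_nhdsWithin_iff.2 ⟨tendsto_one_div_add_atTop_nhds_zero_nat, ?_⟩
    exact Eventually.of_forall fun n => by simp only [mem_Ioi]; positivity
  refine (h1.comp h2).congr fun n => ?_
  simp [h0]

lemma tendsto_nat_mul_one_sub_expNeg {x : ℝ≥0∞} (hx : x ≠ ∞) :
    Tendsto (fun n : ℕ => (n + 1 : ℝ≥0∞) * (1 - expNeg (ENNReal.ofReal (1 / (n + 1)) * x)))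
      atTop (𝓝 x) := by
  lift x to ℝ≥0 using hx
  have hd : HasDerivAt (fun h : ℝ => 1 - Real.exp (-(h * x))) x 0 := by
    have := ((((hasDerivAt_id (0 : ℝ)).mul_const (x : ℝ)).neg).exp).const_sub 1
    simpa using this
  have := (ENNReal.continuous_ofReal.tendsto _).comp
    (tendsto_nat_mul_of_hasDerivAt hd (by simp))
  rw [ENNReal.ofReal_coe_nnreal] at this
  refine this.congr fun n => ?_
  have hn : (0 : ℝ) ≤ 1 / (n + 1) := by positivity
  rw [Function.comp_apply, ENNReal.ofReal_mul (by positivity),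
    ENNReal.ofReal_sub _ (Real.exp_pos _).le, ENNReal.ofReal_one,
    ← expNeg_ofReal (by positivity), ENNReal.ofReal_mul hn, ENNReal.ofReal_coe_nnreal]
  congr 2
  rw [ENNReal.ofReal_add (by positivity) zero_le_one]
  simp

/-- The map h ↦ 1 - exp(-(1 - e^{-h})x) has the same derivative x at 0 as h ↦ 1 - e^{-hx}. The two
limits are the two sides of the Poisson Laplace functional, differentiated in the direction of an
indicator. -/
lemma tendsto_nat_mul_one_sub_expNeg_one_sub_expNeg {x : ℝ≥0∞} (hx : x ≠ ∞) :
    Tendsto (fun n : ℕ => (n + 1 : ℝ≥0∞) *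
      (1 - expNeg ((1 - expNeg (ENNReal.ofReal (1 / (n + 1)))) * x))) atTop (𝓝 x) := by
  lift x to ℝ≥0 using hx
  have hd : HasDerivAt (fun h : ℝ => 1 - Real.exp (-((1 - Real.exp (-h)) * x))) x 0 := by
    have := (((((((hasDerivAt_id (0 : ℝ)).neg).exp).const_sub 1).mul_const (x : ℝ)).neg).exp).const_sub 1
    simpa using this
  have := (ENNReal.continuous_ofReal.tendsto _).comp
    (tendsto_nat_mul_of_hasDerivAt hd (by simp))
  rw [ENNReal.ofReal_coe_nnreal] at this
  refine this.congr fun n => ?_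
  have hn : (0 : ℝ) ≤ 1 / (n + 1) := by positivity
  have hn' : 0 ≤ 1 - Real.exp (-(1 / (n + 1 : ℝ))) := by
    rw [sub_nonneg, Real.exp_le_one_iff]; linarith
  rw [Function.comp_apply, ENNReal.ofReal_mul (by positivity),
    ENNReal.ofReal_sub _ (Real.exp_pos _).le, ENNReal.ofReal_one,
    ← expNeg_ofReal (by positivity), ENNReal.ofReal_mul hn', ENNReal.ofReal_coe_nnreal,
    ENNReal.ofReal_sub _ (Real.exp_pos _).le, ENNReal.ofReal_one, expNeg_ofReal hn]
  congr 2
  rw [ENNReal.ofReal_add (by positivity) zero_le_one]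
  simp

lemma tendsto_tsum_of_monotone {ι : Type*} {f : ℕ → ι → ℝ≥0∞} {g : ι → ℝ≥0∞}
    (hm : ∀ i, Monotone fun n => f n i) (hf : ∀ i, Tendsto (fun n => f n i) atTop (𝓝 (g i))) :
    Tendsto (fun n => ∑' i, f n i) atTop (𝓝 (∑' i, g i)) := by
  let _ : MeasurableSpace ι := ⊤
  simp_rw [← lintegral_count]
  exact lintegral_tendsto_of_tendsto_of_monotone (fun n => measurable_from_top.aemeasurable)
    (Eventually.of_forall hm) (Eventually.of_forall hf)

/-! ### Laplace functional and Mecke's formula for a Poisson process -/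

section

variable {Ω : Type*} {X : ℕ → Ω → Plane}

/-- The value 0 is left out because its level set may have infinite intensity, where the law of the
count is not prescribed. -/
lemma tsum_simpleFunc_apply (f : SimpleFunc Plane ℝ≥0∞) (ω : Ω) :
    ∑' k, f (X k ω) = ∑ c ∈ f.range.filter (· ≠ 0), c * pointCount X (f ⁻¹' {c}) ω := by
  classical
  simp_rw [pointCount, ← ENNReal.tsum_mul_left]
  rw [← Summable.tsum_finsetSum (fun _ _ => ENNReal.summable)]
  refine tsum_congr fun k => ?_
  by_cases h : f (X k ω) = 0
  · rw [h, Finset.sum_eq_zero]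
    intro c hc
    rw [indicator_of_notMem, mul_zero]
    simp only [mem_preimage, mem_singleton_iff, h]
    exact (Finset.mem_filter.1 hc).2.symm
  · rw [Finset.sum_eq_single (f (X k ω))]
    · simp
    · intro c _ hc
      rw [indicator_of_notMem, mul_zero]
      simpa using hc.symm
    · intro hc
      exact absurd (Finset.mem_filter.2 ⟨f.mem_range_self _, h⟩) hc

variable [MeasurableSpace Ω] {P : Measure Ω} {Λ : Measure Plane}

namespace IsPoissonPointProcess

lemma measurable_tsum (hX : IsPoissonPointProcess P X Λ) {u : Plane → ℝ≥0∞} (hu : Measurable u) :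
    Measurable fun ω => ∑' k, u (X k ω) :=
  Measurable.tsum fun k => hu.comp (hX.measurable k)

lemma measurable_pointCount (hX : IsPoissonPointProcess P X Λ) {A : Set Plane}
    (hA : MeasurableSet A) : Measurable (pointCount X A) :=
  hX.measurable_tsum (measurable_const.indicator hA)

lemma lintegral_comp_pointCount (hX : IsPoissonPointProcess P X Λ) {A : Set Plane}
    (hA : MeasurableSet A) (hA' : Λ A ≠ ∞) {f : ℝ≥0∞ → ℝ≥0∞} (hf : Measurable f) :
    ∫⁻ ω, f (pointCount X A ω) ∂P = ∫⁻ n : ℕ, f n ∂(poissonMeasure (Λ A).toNNReal) := by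
  rw [← lintegral_map hf (hX.measurable_pointCount hA), hX.law_count A hA hA',
    lintegral_map hf (measurable_of_countable _)]

lemma lintegral_pointCount (hX : IsPoissonPointProcess P X Λ) {A : Set Plane}
    (hA : MeasurableSet A) (hA' : Λ A ≠ ∞) : ∫⁻ ω, pointCount X A ω ∂P = Λ A := by
  have h := hX.lintegral_comp_pointCount hA hA' measurable_id
  simp only [id, lintegral_natCast_poissonMeasure] at h
  rw [h]
  exact ENNReal.coe_toNNReal hA'

lemma ae_pointCount_lt_top (hX : IsPoissonPointProcess P X Λ) {A : Set Plane}
    (hA : MeasurableSet A) (hA' : Λ A ≠ ∞) : ∀ᵐ ω ∂P, pointCount X A ω < ∞ :=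
  ae_lt_top (hX.measurable_pointCount hA) (by rwa [hX.lintegral_pointCount hA hA'])

lemma lintegral_expNeg_mul_pointCount (hX : IsPoissonPointProcess P X Λ) {A : Set Plane}
    (hA : MeasurableSet A) (hA' : Λ A ≠ ∞) (c : ℝ≥0∞) :
    ∫⁻ ω, expNeg (c * pointCount X A ω) ∂P = expNeg ((1 - expNeg c) * Λ A) := by
  rw [hX.lintegral_comp_pointCount hA hA' (f := fun x => expNeg (c * x))
    (measurable_expNeg.comp (measurable_const_mul c))]
  simp_rw [mul_comm c, expNeg_nat_mul]
  rw [lintegral_pow_poissonMeasure _ (expNeg_le_one c), ENNReal.coe_toNNReal hA', mul_comm]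

lemma iIndepFun_pointCount (hX : IsPoissonPointProcess P X Λ) {ι : Type*} [Fintype ι]
    {A : ι → Set Plane} (hA : ∀ i, MeasurableSet (A i)) (hA' : ∀ i, Λ (A i) ≠ ∞)
    (hd : Pairwise fun i j => Disjoint (A i) (A j)) :
    iIndepFun (fun i => pointCount X (A i)) P := by
  let e := Fintype.equivFin ι
  have := hX.indep_count (Fintype.card ι) (fun i => A (e.symm i)) (fun i => hA _) (fun i => hA' _)
    (fun i j hij => hd (e.symm.injective.ne hij))
  simpa using this.precomp e.injective

/-- The level sets are disjoint, so their counts are independent and the transform is a product of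
Poisson transforms. -/
lemma lintegral_expNeg_simpleFunc (hX : IsPoissonPointProcess P X Λ)
    (f : SimpleFunc Plane ℝ≥0∞) (hf : ∀ c ≠ 0, Λ (f ⁻¹' {c}) ≠ ∞) :
    ∫⁻ ω, expNeg (∑' k, f (X k ω)) ∂P = expNeg (∫⁻ x, (1 - expNeg (f x)) ∂Λ) := by
  set S := f.range.filter (· ≠ 0) with hS
  have hS0 : ∀ c : S, (c : ℝ≥0∞) ≠ 0 := fun c => (Finset.mem_filter.1 c.2).2
  have hm : ∀ c : S, MeasurableSet (f ⁻¹' {(c : ℝ≥0∞)}) := fun c => f.measurableSet_preimage _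
  have hind : iIndepFun (fun c : S => pointCount X (f ⁻¹' {(c : ℝ≥0∞)})) P := by
    refine hX.iIndepFun_pointCount hm (fun c => hf c (hS0 c)) fun c d hcd => ?_
    exact Disjoint.preimage _ (disjoint_singleton.2 fun h => hcd (Subtype.ext h))
  have hind' := hind.comp (fun (c : S) x => expNeg (c * x))
    (fun c => measurable_expNeg.comp (measurable_const_mul (c : ℝ≥0∞)))
  have h1 : ∀ ω, expNeg (∑' k, f (X k ω)) =
      ∏ c : S, expNeg (c * pointCount X (f ⁻¹' {(c : ℝ≥0∞)}) ω) := by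
    intro ω
    rw [tsum_simpleFunc_apply, expNeg_sum, ← Finset.prod_coe_sort]
  simp_rw [h1]
  have h2 := lintegral_prod_eq_prod_lintegral_of_indepFun Finset.univ _ hind' fun c =>
    (measurable_expNeg.comp (measurable_const_mul (c : ℝ≥0∞))).comp
      (hX.measurable_pointCount (hm c))
  simp only [Function.comp_apply] at h2
  rw [h2]
  simp_rw [fun c : S => hX.lintegral_expNeg_mul_pointCount (hm c) (hf c (hS0 c)) c]
  rw [← expNeg_sum]
  congr 1
  have h3 : ∫⁻ x, (1 - expNeg (f x)) ∂Λ = (f.map fun c => 1 - expNeg c).lintegral Λ :=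
    ((f.map fun c => 1 - expNeg c).lintegral_eq_lintegral Λ)
  rw [h3, SimpleFunc.map_lintegral, Finset.sum_coe_sort S (fun c => (1 - expNeg c) * Λ (f ⁻¹' {c})),
    hS, Finset.sum_filter_of_ne]
  rintro c _ hc rfl
  simp at hc

/-- Probability generating functional of a Poisson point process. -/
lemma lintegral_expNeg_tsum [IsProbabilityMeasure P] [SigmaFinite Λ]
    (hX : IsPoissonPointProcess P X Λ) {u : Plane → ℝ≥0∞} (hu : Measurable u) :
    ∫⁻ ω, expNeg (∑' k, u (X k ω)) ∂P = expNeg (∫⁻ x, (1 - expNeg (u x)) ∂Λ) := by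
  -- Restricting to the spanning sets gives the nonzero level sets finite intensity, while the
  -- sequence still increases to `u`.
  let f : ℕ → SimpleFunc Plane ℝ≥0∞ := fun n =>
    (SimpleFunc.eapprox u n).restrict (spanningSets Λ n)
  have hf : ∀ n x, f n x = (spanningSets Λ n).indicator (SimpleFunc.eapprox u n) x := fun n x =>
    SimpleFunc.restrict_apply _ (measurableSet_spanningSets Λ n) x
  have hmono : ∀ x, Monotone fun n => f n x := by
    intro x m n hmn
    simp only [hf]
    exact (indicator_le_indicator (SimpleFunc.monotone_eapprox u hmn x)).trans
      (indicator_le_indicator_of_subset (monotone_spanningSets Λ hmn) (fun _ => zero_le) x)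
  have hlim : ∀ x, Tendsto (fun n => f n x) atTop (𝓝 (u x)) := by
    intro x
    refine (SimpleFunc.tendsto_eapprox hu x).congr' ?_
    filter_upwards [eventually_ge_atTop (spanningSetsIndex Λ x)] with n hn
    rw [hf, indicator_of_mem (mem_spanningSets_of_index_le Λ x hn)]
  have hfin : ∀ n, ∀ c ≠ 0, Λ (f n ⁻¹' {c}) ≠ ∞ := by
    intro n c hc
    rw [SimpleFunc.restrict_preimage_singleton _ (measurableSet_spanningSets Λ n) hc]
    exact ((measure_mono inter_subset_left).trans_lt (measure_spanningSets_lt_top Λ n)).ne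
  have hL : Tendsto (fun n => ∫⁻ ω, expNeg (∑' k, f n (X k ω)) ∂P) atTop
      (𝓝 (∫⁻ ω, expNeg (∑' k, u (X k ω)) ∂P)) := by
    refine tendsto_lintegral_of_dominated_convergence (fun _ => 1) (fun n => ?_) (fun n => ?_)
      (by simp) (Eventually.of_forall fun ω => ?_)
    · exact measurable_expNeg.comp (hX.measurable_tsum (f n).measurable)
    · exact Eventually.of_forall fun ω => expNeg_le_one _
    · exact (continuous_expNeg.tendsto _).comp
        (tendsto_tsum_of_monotone (fun k => hmono _) (fun k => hlim _))
  have hR : Tendsto (fun n => expNeg (∫⁻ x, (1 - expNeg (f n x)) ∂Λ)) atTop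
      (𝓝 (expNeg (∫⁻ x, (1 - expNeg (u x)) ∂Λ))) := by
    refine (continuous_expNeg.tendsto _).comp (lintegral_tendsto_of_tendsto_of_monotone
      (fun n => ?_) (Eventually.of_forall fun x => ?_) (Eventually.of_forall fun x => ?_))
    · exact (measurable_const.sub (measurable_expNeg.comp (f n).measurable)).aemeasurable
    · exact fun m n hmn => tsub_le_tsub_left (antitone_expNeg (hmono x hmn)) 1
    · exact ENNReal.Tendsto.sub tendsto_const_nhds ((continuous_expNeg.tendsto _).comp (hlim x))
        (Or.inl ENNReal.one_ne_top)
  refine tendsto_nhds_unique hL (hR.congr fun n => ?_)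
  exact (hX.lintegral_expNeg_simpleFunc (f n) (hfin n)).symm

/-- This is the right derivative at s = 0 of the Laplace functional of u + s·1_A. Its exponent is I
+ (1 - e^{-s})q with q = ∫_A e^{-u} dΛ, whence the factor q. -/
lemma lintegral_pointCount_mul_expNeg_tsum [IsProbabilityMeasure P] [SigmaFinite Λ]
    (hX : IsPoissonPointProcess P X Λ) {u : Plane → ℝ≥0∞} (hu : Measurable u) {A : Set Plane}
    (hA : MeasurableSet A) (hA' : Λ A ≠ ∞) :
    ∫⁻ ω, pointCount X A ω * expNeg (∑' k, u (X k ω)) ∂P =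
      (∫⁻ x in A, expNeg (u x) ∂Λ) * expNeg (∫⁻ x, (1 - expNeg (u x)) ∂Λ) := by
  set q := ∫⁻ x in A, expNeg (u x) ∂Λ with hq
  set I := ∫⁻ x, (1 - expNeg (u x)) ∂Λ with hI
  have hqtop : q ≠ ∞ := by
    refine ne_top_of_le_ne_top hA' ?_
    calc q ≤ ∫⁻ x in A, 1 ∂Λ := lintegral_mono fun x => expNeg_le_one _
      _ = Λ A := by simp
  have hmN := hX.measurable_pointCount hA
  have hmS := hX.measurable_tsum hu
  let s : ℕ → ℝ≥0∞ := fun n => ENNReal.ofReal (1 / (n + 1))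
  have hs : ∀ n : ℕ, (n + 1 : ℝ≥0∞) * s n = 1 := by
    intro n
    have : (n + 1 : ℝ≥0∞) = ENNReal.ofReal (n + 1) := by
      rw [ENNReal.ofReal_add (by positivity) zero_le_one]; simp
    rw [this, ← ENNReal.ofReal_mul (by positivity), mul_one_div_cancel (by positivity),
      ENNReal.ofReal_one]
  let v : ℕ → Plane → ℝ≥0∞ := fun n x => u x + s n * A.indicator (fun _ => 1) x
  have hv : ∀ n, Measurable (v n) := fun n =>
    hu.add ((measurable_const.indicator hA).const_mul _)
  have hsum : ∀ n ω, ∑' k, v n (X k ω) = ∑' k, u (X k ω) + s n * pointCount X A ω := by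
    intro n ω
    simp only [v]
    rw [ENNReal.tsum_add, ENNReal.tsum_mul_left]; rfl
  have hint : ∀ n, ∫⁻ x, (1 - expNeg (v n x)) ∂Λ = I + (1 - expNeg (s n)) * q := by
    intro n
    have h1 : ∀ x, 1 - expNeg (v n x) =
        (1 - expNeg (u x)) + A.indicator (fun x => (1 - expNeg (s n)) * expNeg (u x)) x := by
      intro x
      by_cases hx : x ∈ A
      · simp only [v, indicator_of_mem hx, mul_one]
        rw [expNeg_add, ENNReal.sub_mul (fun _ _ => expNeg_ne_top _), one_mul,
          mul_comm (expNeg (s n)), tsub_add_tsub_cancel (expNeg_le_one _)]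
        exact mul_le_of_le_one_right' (expNeg_le_one _)
      · simp [v, indicator_of_notMem hx]
    simp_rw [h1]
    rw [lintegral_add_left (by fun_prop), lintegral_indicator hA, lintegral_const_mul _ (by fun_prop)]
  have hstep : ∀ n : ℕ, ∫⁻ ω, (n + 1 : ℝ≥0∞) * (1 - expNeg (s n * pointCount X A ω)) *
      expNeg (∑' k, u (X k ω)) ∂P =
        (n + 1 : ℝ≥0∞) * (1 - expNeg ((1 - expNeg (s n)) * q)) * expNeg I := by
    intro n
    have h1 : ∀ ω, (n + 1 : ℝ≥0∞) * (1 - expNeg (s n * pointCount X A ω)) *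
        expNeg (∑' k, u (X k ω)) =
        (n + 1 : ℝ≥0∞) * (expNeg (∑' k, u (X k ω)) - expNeg (∑' k, v n (X k ω))) := by
      intro ω
      rw [hsum, expNeg_add, mul_assoc, ENNReal.sub_mul (fun _ _ => expNeg_ne_top _), one_mul,
        mul_comm (expNeg (s n * _))]
    simp_rw [h1]
    have hmv := hX.measurable_tsum (hv n)
    rw [lintegral_const_mul _ (by fun_prop), lintegral_sub (by fun_prop),
      hX.lintegral_expNeg_tsum hu, hX.lintegral_expNeg_tsum (hv n), hint, expNeg_add, mul_assoc,
      ENNReal.sub_mul (fun _ _ => expNeg_ne_top _), one_mul, mul_comm (expNeg I)]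
    · rw [hX.lintegral_expNeg_tsum (hv n)]; exact expNeg_ne_top _
    · refine Eventually.of_forall fun ω => ?_
      simp only [hsum]
      exact antitone_expNeg le_self_add
  have hR : Tendsto (fun n : ℕ => (n + 1 : ℝ≥0∞) * (1 - expNeg ((1 - expNeg (s n)) * q)) *
      expNeg I) atTop (𝓝 (q * expNeg I)) :=
    ENNReal.Tendsto.mul_const (tendsto_nat_mul_one_sub_expNeg_one_sub_expNeg hqtop)
      (Or.inr (expNeg_ne_top _))
  refine tendsto_nhds_unique ?_ hR
  simp_rw [← hstep]
  refine tendsto_lintegral_of_dominated_convergence (pointCount X A) (fun n => by fun_prop)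
    (fun n => Eventually.of_forall fun ω => ?_) (by rwa [hX.lintegral_pointCount hA hA']) ?_
  -- By 1 - e^{-x} ≤ x the difference quotients are dominated by the number of points in A, which is
  -- integrable.
  · calc _ ≤ (n + 1 : ℝ≥0∞) * (s n * pointCount X A ω) * 1 := 
          mul_le_mul' (mul_le_mul' le_rfl (one_sub_expNeg_le _)) (expNeg_le_one _)
      _ = pointCount X A ω := by rw [mul_one, ← mul_assoc, hs, one_mul]
  · filter_upwards [hX.ae_pointCount_lt_top hA hA'] with ω hω
    exact ENNReal.Tendsto.mul_const (tendsto_nat_mul_one_sub_expNeg hω.ne)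
      (Or.inr (expNeg_ne_top _))

/-- For f an indicator of a set of finite intensity this is the preceding lemma. As functions of the
set, both sides are measures, so they agree everywhere by exhaustion, and f can be integrated
against them. -/
lemma lintegral_tsum_mul_expNeg_tsum [IsProbabilityMeasure P] [SigmaFinite Λ]
    (hX : IsPoissonPointProcess P X Λ) {u f : Plane → ℝ≥0∞} (hu : Measurable u)
    (hf : Measurable f) :
    ∫⁻ ω, ∑' i, f (X i ω) * expNeg (∑' k, u (X k ω)) ∂P =
      (∫⁻ x, f x * expNeg (u x) ∂Λ) * expNeg (∫⁻ x, (1 - expNeg (u x)) ∂Λ) := by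
  have hmS := hX.measurable_tsum hu
  have hmE : Measurable fun ω => expNeg (∑' k, u (X k ω)) := measurable_expNeg.comp hmS
  set L := expNeg (∫⁻ x, (1 - expNeg (u x)) ∂Λ) with hL
  let ν₁ : Measure Plane := Measure.sum fun i =>
    (P.withDensity fun ω => expNeg (∑' k, u (X k ω))).map (X i)
  let ν₂ : Measure Plane := L • Λ.withDensity fun x => expNeg (u x)
  have hfin : ∀ A, MeasurableSet A → Λ A ≠ ∞ → ν₁ A = ν₂ A := by
    intro A hA hA'
    have h1 : ν₁ A = ∫⁻ ω, pointCount X A ω * expNeg (∑' k, u (X k ω)) ∂P := by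
      simp only [ν₁]
      rw [Measure.sum_apply _ hA]
      have : ∀ i, ((P.withDensity fun ω => expNeg (∑' k, u (X k ω))).map (X i)) A =
          ∫⁻ ω, A.indicator (fun _ => 1) (X i ω) * expNeg (∑' k, u (X k ω)) ∂P := by
        intro i
        rw [Measure.map_apply (hX.measurable i) hA,
          withDensity_apply _ (hX.measurable i hA), ← lintegral_indicator (hX.measurable i hA)]
        refine lintegral_congr fun ω => ?_
        by_cases h : X i ω ∈ A
        · simp [indicator_of_mem, h]
        · simp [indicator_of_notMem, h]
      simp_rw [this]
      rw [← lintegral_tsum (fun i => Measurable.aemeasurable ?_)]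
      swap
      · exact ((measurable_const.indicator hA).comp (hX.measurable i)).mul
          (measurable_expNeg.comp hmS)
      simp_rw [ENNReal.tsum_mul_right]
      rfl
    rw [h1, hX.lintegral_pointCount_mul_expNeg_tsum hu hA hA']
    simp only [ν₂, Measure.smul_apply, smul_eq_mul, withDensity_apply _ hA]
    rw [mul_comm]
  have hν : ν₁ = ν₂ := by
    refine Measure.ext fun A hA => ?_
    have hU : A = ⋃ n, A ∩ spanningSets Λ n := by
      rw [← inter_iUnion, iUnion_spanningSets, inter_univ]
    have hm : Monotone fun n => A ∩ spanningSets Λ n := fun m n hmn =>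
      inter_subset_inter_right _ (monotone_spanningSets Λ hmn)
    rw [hU, hm.measure_iUnion, hm.measure_iUnion]
    refine iSup_congr fun n => hfin _ (hA.inter (measurableSet_spanningSets Λ n)) ?_
    exact ((measure_mono inter_subset_right).trans_lt (measure_spanningSets_lt_top Λ n)).ne
  have h1 : ∫⁻ x, f x ∂ν₁ = ∫⁻ ω, ∑' i, f (X i ω) * expNeg (∑' k, u (X k ω)) ∂P := by
    simp only [ν₁]
    rw [lintegral_sum_measure, lintegral_tsum (fun i => Measurable.aemeasurable ?_)]
    swap
    · exact (hf.comp (hX.measurable i)).mul (measurable_expNeg.comp hmS)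
    refine tsum_congr fun i => ?_
    rw [lintegral_map hf (hX.measurable i),
      lintegral_withDensity_eq_lintegral_mul _ hmE
        (g := fun ω => f (X i ω)) (hf.comp (hX.measurable i))]
    exact lintegral_congr fun ω => mul_comm _ _
  rw [← h1, hν]
  simp only [ν₂]
  rw [lintegral_smul_measure, lintegral_withDensity_eq_lintegral_mul _ (by fun_prop) hf, smul_eq_mul,
    mul_comm]
  congr 1
  exact lintegral_congr fun x => mul_comm _ _

/-- Mecke's formula for multiplicative functionals of the remaining points. -/
lemma lintegral_tsum_mul_expNeg_tsum_ne [IsProbabilityMeasure P] [SigmaFinite Λ]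
    (hX : IsPoissonPointProcess P X Λ) {u f : Plane → ℝ≥0∞} (hu : Measurable u)
    (hu' : ∀ x, u x ≠ ∞) (hf : Measurable f) :
    ∫⁻ ω, ∑' i, f (X i ω) * expNeg (∑' k, if k = i then 0 else u (X k ω)) ∂P =
      (∫⁻ x, f x ∂Λ) * expNeg (∫⁻ x, (1 - expNeg (u x)) ∂Λ) := by
  -- The extra weight e^{u(X_i)} cancels the factor of the point i in the product; finiteness of `u`
  -- makes e^{-u} invertible.
  have h := hX.lintegral_tsum_mul_expNeg_tsum (f := fun x => f x * (expNeg (u x))⁻¹) hu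
    (by fun_prop)
  have h1 : ∀ x, (expNeg (u x))⁻¹ * expNeg (u x) = 1 := fun x =>
    ENNReal.inv_mul_cancel (expNeg_ne_zero (hu' x)) (expNeg_ne_top _)
  simp_rw [mul_assoc, h1, mul_one] at h
  rw [← h]
  refine lintegral_congr fun ω => tsum_congr fun i => ?_
  rw [ENNReal.tsum_eq_add_tsum_ite (f := fun k => u (X k ω)) i, expNeg_add, ← mul_assoc (_)⁻¹, h1,
    one_mul]
  congr!

end IsPoissonPointProcess

end

/-! ### Mecke's formula seen from the chosen point -/

namespace IsPoissonPointProcess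

variable {Ω : Type*} {X : ℕ → Ω → Plane} [MeasurableSpace Ω] {P : Measure Ω} {Λ : Measure Plane}

/-- Campbell's formula. -/
lemma lintegral_tsum [IsProbabilityMeasure P] [SigmaFinite Λ]
    (hX : IsPoissonPointProcess P X Λ) {f : Plane → ℝ≥0∞} (hf : Measurable f) :
    ∫⁻ ω, ∑' i, f (X i ω) ∂P = ∫⁻ x, f x ∂Λ := by
  simpa using hX.lintegral_tsum_mul_expNeg_tsum (u := fun _ => 0) measurable_const hf

/-- Dominated convergence is applied twice, to the sum over points and to the expectation, with
dominating function f(X_i), summable almost surely by Campbell's formula. -/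
lemma tendsto_lintegral_tsum_mul [IsProbabilityMeasure P] [SigmaFinite Λ]
    (hX : IsPoissonPointProcess P X Λ) {f : Plane → ℝ≥0∞} (hf : Measurable f)
    (hf' : ∫⁻ x, f x ∂Λ ≠ ∞) {g : ℕ → ℕ → Ω → ℝ≥0∞} {g' : ℕ → Ω → ℝ≥0∞}
    (hg : ∀ n i, Measurable (g n i)) (hg1 : ∀ n i ω, g n i ω ≤ 1)
    (hlim : ∀ᵐ ω ∂P, ∀ i, Tendsto (fun n => g n i ω) atTop (𝓝 (g' i ω))) :
    Tendsto (fun n => ∫⁻ ω, ∑' i, f (X i ω) * g n i ω ∂P) atTop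
      (𝓝 (∫⁻ ω, ∑' i, f (X i ω) * g' i ω ∂P)) := by
  have hint : ∫⁻ ω, ∑' i, f (X i ω) ∂P ≠ ∞ := by rwa [hX.lintegral_tsum hf]
  refine tendsto_lintegral_of_dominated_convergence (fun ω => ∑' i, f (X i ω))
    (fun n => Measurable.tsum fun i => (hf.comp (hX.measurable i)).mul (hg n i))
    (fun n => Eventually.of_forall fun ω => ENNReal.tsum_le_tsum fun i =>
      mul_le_of_le_one_right' (hg1 n i ω)) hint ?_
  filter_upwards [hlim, ae_lt_top (hX.measurable_tsum hf) hint] with ω hω hfin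
  have hfi : ∀ i, f (X i ω) ≠ ∞ := fun i => ENNReal.ne_top_of_tsum_ne_top hfin.ne i
  let _ : MeasurableSpace ℕ := ⊤
  simp_rw [← lintegral_count] at hfin ⊢
  exact tendsto_lintegral_of_dominated_convergence (fun i => f (X i ω))
    (fun n => measurable_from_top)
    (fun n => Eventually.of_forall fun i => mul_le_of_le_one_right' (hg1 n i ω)) hfin.ne
    (Eventually.of_forall fun i => ENNReal.Tendsto.const_mul (hω i) (Or.inr (hfi i)))

lemma measurable_tsum_sub (hX : IsPoissonPointProcess P X Λ) {u : Plane → ℝ≥0∞}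
    (hu : Measurable u) {q : Plane → Plane} (hq : Measurable q) (i : ℕ) :
    Measurable fun ω => ∑' k, if k = i then 0 else u (X k ω - q (X i ω)) := by
  refine Measurable.tsum fun k => ?_
  split_ifs
  · exact measurable_const
  · exact hu.comp ((hX.measurable k).sub (hq.comp (hX.measurable i)))

/-- On each of the finitely many pieces {q = c} the functional uses the fixed function u(· - c), so
the previous form of Mecke's formula applies. Translation invariance gives the same factor for all
c. -/
lemma lintegral_tsum_mul_expNeg_tsum_sub_simpleFunc [IsProbabilityMeasure P] [SigmaFinite Λ]
    [Λ.IsAddRightInvariant] (hX : IsPoissonPointProcess P X Λ) {f u : Plane → ℝ≥0∞}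
    (hf : Measurable f) (hu : Measurable u) (hu' : ∀ x, u x ≠ ∞) (q : SimpleFunc Plane Plane) :
    ∫⁻ ω, ∑' i, f (X i ω) * expNeg (∑' k, if k = i then 0 else u (X k ω - q (X i ω))) ∂P =
      (∫⁻ x, f x ∂Λ) * expNeg (∫⁻ x, (1 - expNeg (u x)) ∂Λ) := by
  classical
  have hdec : ∀ x (G : Plane → ℝ≥0∞), f x * G (q x) =
      ∑ c ∈ q.range, (q ⁻¹' {c}).indicator f x * G c := by
    intro x G
    rw [Finset.sum_eq_single (q x)]
    · simp
    · intro c _ hc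
      rw [indicator_of_notMem, zero_mul]
      simpa using hc.symm
    · exact fun h => absurd (q.mem_range_self x) h
  have hmi : ∀ c, Measurable ((q ⁻¹' {c}).indicator f) := fun c =>
    hf.indicator (q.measurableSet_preimage _)
  have h1 : ∀ ω, ∑' i, f (X i ω) * expNeg (∑' k, if k = i then 0 else u (X k ω - q (X i ω))) =
      ∑ c ∈ q.range, ∑' i, (q ⁻¹' {c}).indicator f (X i ω) *
        expNeg (∑' k, if k = i then 0 else u (X k ω - c)) := by
    intro ω
    rw [← Summable.tsum_finsetSum (fun _ _ => ENNReal.summable)]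
    exact tsum_congr fun i => hdec (X i ω) fun c =>
      expNeg (∑' k, if k = i then 0 else u (X k ω - c))
  simp_rw [h1]
  rw [lintegral_finsetSum]
  swap
  · intro c _
    exact Measurable.tsum fun i => ((hmi c).comp (hX.measurable i)).mul
      (measurable_expNeg.comp (hX.measurable_tsum_sub hu (measurable_const (a := c)) i))
  have h2 : ∀ c : Plane, ∫⁻ ω, ∑' i, (q ⁻¹' {c}).indicator f (X i ω) *
        expNeg (∑' k, if k = i then 0 else u (X k ω - c)) ∂P =
      (∫⁻ x, (q ⁻¹' {c}).indicator f x ∂Λ) * expNeg (∫⁻ x, (1 - expNeg (u x)) ∂Λ) := by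
    intro c
    rw [hX.lintegral_tsum_mul_expNeg_tsum_ne (u := fun x => u (x - c))
      (hu.comp (measurable_id.sub_const c)) (fun x => hu' _) (hmi c),
      lintegral_sub_right_eq_self (fun x => 1 - expNeg (u x)) c]
  simp_rw [h2]
  rw [← Finset.sum_mul, ← lintegral_finsetSum _ fun c _ => hmi c]
  congr 1
  refine lintegral_congr fun x => ?_
  have := hdec x fun _ => 1
  simpa using this.symm

/-- X_i is replaced by simple approximations q_n(X_i). Continuity of `u` gives convergence of each
term, and bounded support with local finiteness of the process dominates the sum over k. -/
lemma lintegral_tsum_mul_expNeg_tsum_sub_of_bounded [IsProbabilityMeasure P] [SigmaFinite Λ]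
    [Λ.IsAddRightInvariant] [IsFiniteMeasureOnCompacts Λ] (hX : IsPoissonPointProcess P X Λ)
    {f : Plane → ℝ≥0∞} (hf : Measurable f) (hf' : ∫⁻ x, f x ∂Λ ≠ ∞) {u : Plane → ℝ≥0}
    (hu : Continuous u) {C : ℝ≥0} (hC : ∀ x, u x ≤ C) {R : ℝ} (hR : ∀ x, R ≤ ‖x‖ → u x = 0) :
    ∫⁻ ω, ∑' i, f (X i ω) *
        expNeg (∑' k, if k = i then 0 else (u (X k ω - X i ω) : ℝ≥0∞)) ∂P =
      (∫⁻ x, f x ∂Λ) * expNeg (∫⁻ x, (1 - expNeg (u x)) ∂Λ) := by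
  have huc : Continuous fun x => (u x : ℝ≥0∞) := ENNReal.continuous_coe.comp hu
  let q : ℕ → SimpleFunc Plane Plane :=
    SimpleFunc.approxOn id measurable_id univ 0 (mem_univ _)
  have hq : ∀ x, Tendsto (fun n => q n x) atTop (𝓝 x) := fun x =>
    SimpleFunc.tendsto_approxOn measurable_id (mem_univ _) (by simp)
  have hmeas : ∀ n i, Measurable fun ω =>
      expNeg (∑' k, if k = i then 0 else (u (X k ω - q n (X i ω)) : ℝ≥0∞)) := fun n i =>
    measurable_expNeg.comp (hX.measurable_tsum_sub huc.measurable (q n).measurable i)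
  have hlim := hX.tendsto_lintegral_tsum_mul hf hf' hmeas (fun n i ω => expNeg_le_one _)
    (g' := fun i ω => expNeg (∑' k, if k = i then 0 else (u (X k ω - X i ω) : ℝ≥0∞))) ?_
  · refine tendsto_nhds_unique hlim (tendsto_const_nhds.congr fun n => ?_)
    exact (hX.lintegral_tsum_mul_expNeg_tsum_sub_simpleFunc hf huc.measurable
      (fun x => ENNReal.coe_ne_top) (q n)).symm
  have hball : ∀ N : ℕ, Λ (Metric.ball 0 N) ≠ ∞ := fun N => measure_ball_lt_top.ne
  filter_upwards [ae_all_iff.2 fun N : ℕ =>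
    hX.ae_pointCount_lt_top measurableSet_ball (hball N)] with ω hω i
  refine (continuous_expNeg.tendsto _).comp ?_
  -- Once q_n(X_i) is within 1 of X_i, a point of norm at least N is at distance at least R from
  -- q_n(X_i), so its term vanishes.
  obtain ⟨N, hN⟩ := exists_nat_gt (R + ‖X i ω‖ + 1)
  let _ : MeasurableSpace ℕ := ⊤
  have hbd : ∑' k, (C : ℝ≥0∞) * (Metric.ball (0 : Plane) N).indicator (fun _ => 1) (X k ω) ≠ ∞ := by
    rw [ENNReal.tsum_mul_left]
    exact ENNReal.mul_ne_top ENNReal.coe_ne_top (hω N).ne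
  simp_rw [← lintegral_count] at hbd ⊢
  refine tendsto_lintegral_filter_of_dominated_convergence _
    (Eventually.of_forall fun n => measurable_from_top) ?_ hbd (Eventually.of_forall fun k => ?_)
  · filter_upwards [(hq (X i ω)).eventually (Metric.ball_mem_nhds _ one_pos)] with n hn
    refine Eventually.of_forall fun k => ?_
    split_ifs with h
    · exact zero_le
    by_cases hk : X k ω ∈ Metric.ball (0 : Plane) N
    · rw [indicator_of_mem hk, mul_one]
      exact ENNReal.coe_le_coe.2 (hC _)
    · rw [hR, ENNReal.coe_zero]
      · exact zero_le
      rw [mem_ball_zero_iff, not_lt] at hk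
      rw [dist_eq_norm] at hn
      have h1 := norm_sub_norm_le (X k ω) (q n (X i ω))
      have h2 := norm_sub_norm_le (q n (X i ω)) (X i ω)
      linarith
  · split_ifs
    · exact tendsto_const_nhds
    · exact (huc.tendsto _).comp (tendsto_const_nhds.sub (hq _))

/-- Mecke's formula for multiplicative functionals of the remaining points, seen from the chosen
point. -/
lemma lintegral_tsum_mul_expNeg_tsum_sub [IsProbabilityMeasure P] [SigmaFinite Λ]
    [Λ.IsAddRightInvariant] [IsFiniteMeasureOnCompacts Λ] (hX : IsPoissonPointProcess P X Λ)
    {f : Plane → ℝ≥0∞} (hf : Measurable f) (hf' : ∫⁻ x, f x ∂Λ ≠ ∞) {u : Plane → ℝ≥0}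
    (hu : Continuous u) {C : ℝ≥0} (hC : ∀ x, u x ≤ C) :
    ∫⁻ ω, ∑' i, f (X i ω) *
        expNeg (∑' k, if k = i then 0 else (u (X k ω - X i ω) : ℝ≥0∞)) ∂P =
      (∫⁻ x, f x ∂Λ) * expNeg (∫⁻ x, (1 - expNeg (u x)) ∂Λ) := by
  -- Continuous cutoffs increasing to 1, each vanishing off a ball: they reduce to bounded support,
  -- and monotone convergence removes them.
  let χ : ℕ → Plane → ℝ≥0 := fun n x => min 1 (Real.toNNReal (n - ‖x‖))
  have hχc : ∀ n, Continuous (χ n) := fun n => by fun_prop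
  have hχm : ∀ x, Monotone fun n => χ n x := fun x m n hmn => by
    simp only [χ]; gcongr
  have hχ1 : ∀ n x, χ n x ≤ 1 := fun n x => min_le_left _ _
  have hχ0 : ∀ (n : ℕ) x, (n : ℝ) ≤ ‖x‖ → χ n x = 0 := fun n x h => by
    simp [χ, Real.toNNReal_of_nonpos (sub_nonpos.2 h)]
  have hχlim : ∀ x, Tendsto (fun n => χ n x) atTop (𝓝 1) := by
    intro x
    obtain ⟨N, hN⟩ := exists_nat_ge (1 + ‖x‖)
    refine tendsto_const_nhds.congr' ?_
    filter_upwards [eventually_ge_atTop N] with n hn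
    have : (N : ℝ) ≤ n := by exact_mod_cast hn
    simp only [χ]
    rw [min_eq_left]
    rw [Real.le_toNNReal_iff_coe_le (by linarith [norm_nonneg x])]
    push_cast; linarith
  let v : ℕ → Plane → ℝ≥0 := fun n x => u x * χ n x
  have hvc : ∀ n, Continuous (v n) := fun n => hu.mul (hχc n)
  have hvm : ∀ x, Monotone fun n => (v n x : ℝ≥0∞) := fun x m n hmn =>
    ENNReal.coe_le_coe.2 (mul_le_mul' le_rfl (hχm x hmn))
  have hvlim : ∀ x, Tendsto (fun n => (v n x : ℝ≥0∞)) atTop (𝓝 (u x)) := fun x => by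
    have := (hχlim x).const_mul (u x)
    rw [mul_one] at this
    exact ENNReal.tendsto_coe.2 this
  have hvmeas : ∀ n, Measurable fun x => (v n x : ℝ≥0∞) := fun n =>
    (hvc n).measurable.coe_nnreal_ennreal
  have hmeas : ∀ n i, Measurable fun ω =>
      expNeg (∑' k, if k = i then 0 else (v n (X k ω - X i ω) : ℝ≥0∞)) := fun n i =>
    measurable_expNeg.comp (hX.measurable_tsum_sub (hvmeas n) measurable_id i)
  have hlim := hX.tendsto_lintegral_tsum_mul hf hf' hmeas (fun n i ω => expNeg_le_one _)
    (g' := fun i ω => expNeg (∑' k, if k = i then 0 else (u (X k ω - X i ω) : ℝ≥0∞)))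
    (Eventually.of_forall fun ω i => (continuous_expNeg.tendsto _).comp
      (tendsto_tsum_of_monotone (fun k => ?_) (fun k => ?_)))
  rotate_left
  · split_ifs
    · exact monotone_const
    · exact hvm _
  · split_ifs
    · exact tendsto_const_nhds
    · exact hvlim _
  have hR : Tendsto (fun n => (∫⁻ x, f x ∂Λ) * expNeg (∫⁻ x, (1 - expNeg (v n x)) ∂Λ)) atTop
      (𝓝 ((∫⁻ x, f x ∂Λ) * expNeg (∫⁻ x, (1 - expNeg (u x)) ∂Λ))) := by
    refine ENNReal.Tendsto.const_mul ?_ (Or.inr hf')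
    refine (continuous_expNeg.tendsto _).comp (lintegral_tendsto_of_tendsto_of_monotone
      (fun n => ?_) (Eventually.of_forall fun x => ?_) (Eventually.of_forall fun x => ?_))
    · exact (measurable_const.sub (measurable_expNeg.comp (hvmeas n))).aemeasurable
    · exact fun m n hmn => tsub_le_tsub_left (antitone_expNeg (hvm x hmn)) 1
    · exact ENNReal.Tendsto.sub tendsto_const_nhds ((continuous_expNeg.tendsto _).comp (hvlim x))
        (Or.inl ENNReal.one_ne_top)
  refine tendsto_nhds_unique hlim (hR.congr fun n => ?_)
  refine (hX.lintegral_tsum_mul_expNeg_tsum_sub_of_bounded hf hf' (hvc n) (C := C)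
    (fun x => ?_) (R := n) (fun x hx => ?_)).symm
  · exact (mul_le_of_le_one_right' (hχ1 n x)).trans (hC x)
  · simp [v, hχ0 n x hx]

end IsPoissonPointProcess

/-! ### Infinite products and pairing of independent families -/

section InfinitePi

variable {ι : Type*} {E : ι → Type*} [∀ i, MeasurableSpace (E i)] (μ : ∀ i, Measure (E i))
  [∀ i, IsProbabilityMeasure (μ i)]

lemma lintegral_infinitePi_prod (s : Finset ι) {g : ∀ i, E i → ℝ≥0∞} (hg : ∀ i, Measurable (g i)) :
    ∫⁻ x, ∏ i ∈ s, g i (x i) ∂(Measure.infinitePi μ) = ∏ i ∈ s, ∫⁻ a, g i a ∂(μ i) := by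
  have hm : ∀ i, Measurable fun x : (∀ i, E i) => g i (x i) := fun i =>
    (hg i).comp (measurable_pi_apply i)
  rw [lintegral_prod_eq_prod_lintegral_of_indepFun s _ (iIndepFun_infinitePi hg) hm]
  refine Finset.prod_congr rfl fun i _ => ?_
  rw [← lintegral_map (hg i) (measurable_pi_apply i), Measure.infinitePi_map_eval]

lemma lintegral_infinitePi_expNeg_tsum {E : ℕ → Type*} [∀ i, MeasurableSpace (E i)]
    (μ : ∀ i, Measure (E i)) [∀ i, IsProbabilityMeasure (μ i)] {g : ∀ i, E i → ℝ≥0∞}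
    (hg : ∀ i, Measurable (g i)) {a : ℕ → ℝ≥0∞}
    (ha : ∀ i, ∫⁻ x, expNeg (g i x) ∂(μ i) = expNeg (a i)) :
    ∫⁻ x, expNeg (∑' i, g i (x i)) ∂(Measure.infinitePi μ) = expNeg (∑' i, a i) := by
  have hm : ∀ i, Measurable fun x : (∀ i, E i) => g i (x i) := fun i =>
    (hg i).comp (measurable_pi_apply i)
  have hL : Tendsto (fun n => ∫⁻ x, expNeg (∑ i ∈ Finset.range n, g i (x i))
      ∂(Measure.infinitePi μ)) atTop
      (𝓝 (∫⁻ x, expNeg (∑' i, g i (x i)) ∂(Measure.infinitePi μ))) := by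
    refine tendsto_lintegral_of_dominated_convergence (fun _ => 1) (fun n => ?_)
      (fun n => Eventually.of_forall fun x => expNeg_le_one _) (by simp)
      (Eventually.of_forall fun x => (continuous_expNeg.tendsto _).comp
        ENNReal.summable.hasSum.tendsto_sum_nat)
    exact measurable_expNeg.comp (Finset.measurable_sum _ fun i _ => hm i)
  have hR : Tendsto (fun n => expNeg (∑ i ∈ Finset.range n, a i)) atTop
      (𝓝 (expNeg (∑' i, a i))) :=
    (continuous_expNeg.tendsto _).comp ENNReal.summable.hasSum.tendsto_sum_nat
  refine tendsto_nhds_unique hL (hR.congr fun n => ?_)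
  simp_rw [expNeg_sum]
  rw [lintegral_infinitePi_prod μ _ (g := fun i x => expNeg (g i x))
    fun i => measurable_expNeg.comp (hg i)]
  exact Finset.prod_congr rfl fun i _ => (ha i).symm

/-- Resampling one coordinate leaves a product measure invariant. -/
lemma map_update_prod_infinitePi [DecidableEq ι] (i : ι) :
    ((μ i).prod (Measure.infinitePi μ)).map (fun p => Function.update p.2 i p.1) =
      Measure.infinitePi μ := by
  have hm : Measurable fun p : E i × (∀ i, E i) => Function.update p.2 i p.1 := by
    refine measurable_pi_iff.2 fun j => ?_
    by_cases h : j = i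
    · subst h; simpa using measurable_fst
    · simp only [Function.update_of_ne h]
      exact (measurable_pi_apply j).comp measurable_snd
  refine Measure.eq_infinitePi μ fun s t ht => ?_
  rw [Measure.map_apply hm (MeasurableSet.pi s.countable_toSet fun j _ => ht j)]
  by_cases hi : i ∈ s
  · have : (fun p : E i × (∀ i, E i) => Function.update p.2 i p.1) ⁻¹' Set.pi s t =
        t i ×ˢ Set.pi (s.erase i) t := by
      ext ⟨a, x⟩
      simp only [mem_preimage, Set.mem_pi, mem_prod, Finset.mem_coe, Finset.mem_erase]
      constructor
      · intro h
        refine ⟨by simpa using h i hi, fun j hj => by simpa [hj.1] using h j hj.2⟩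
      · rintro ⟨h1, h2⟩ j hj
        by_cases h : j = i
        · subst h; simpa using h1
        · simpa [h] using h2 j ⟨h, hj⟩
    rw [this, Measure.prod_prod, Measure.infinitePi_pi _ fun j _ => ht j,
      Finset.mul_prod_erase s (fun j => μ j (t j)) hi]
  · have : (fun p : E i × (∀ i, E i) => Function.update p.2 i p.1) ⁻¹' Set.pi s t =
        univ ×ˢ Set.pi s t := by
      ext ⟨a, x⟩
      simp only [mem_preimage, Set.mem_pi, mem_prod, mem_univ, true_and]
      refine forall₂_congr fun j hj => ?_
      rw [Function.update_of_ne]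
      rintro rfl
      exact hi hj
    rw [this, Measure.prod_prod, Measure.infinitePi_pi _ fun j _ => ht j, measure_univ, one_mul]

/-- This isolates the marks of the representative cluster: coordinate i is frozen at a while the
others are averaged. -/
lemma lintegral_infinitePi_update [DecidableEq ι] (i : ι) {Φ : (∀ i, E i) → ℝ≥0∞}
    (hΦ : Measurable Φ) :
    ∫⁻ x, Φ x ∂(Measure.infinitePi μ) =
      ∫⁻ a, ∫⁻ x, Φ (Function.update x i a) ∂(Measure.infinitePi μ) ∂(μ i) := by
  have hm : Measurable fun p : E i × (∀ i, E i) => Function.update p.2 i p.1 := by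
    refine measurable_pi_iff.2 fun j => ?_
    by_cases h : j = i
    · subst h; simpa using measurable_fst
    · simp only [Function.update_of_ne h]
      exact (measurable_pi_apply j).comp measurable_snd
  conv_lhs => rw [← map_update_prod_infinitePi μ i]
  have hΦm : Measurable fun p : E i × (∀ i, E i) => Φ (Function.update p.2 i p.1) := hΦ.comp hm
  rw [lintegral_map hΦ hm, lintegral_prod _ hΦm.aemeasurable]

end InfinitePi

section Combine

variable {Ω ι : Type*} {E F : ι → Type*} [∀ i, MeasurableSpace (E i)] [∀ i, MeasurableSpace (F i)]
  [MeasurableSpace Ω] {P : Measure Ω}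

/-- Two mutually independent families of independent random variables, paired up. -/
lemma iIndepFun_prodMk {f : ∀ i, Ω → E i} {g : ∀ i, Ω → F i} (hfm : ∀ i, Measurable (f i))
    (hgm : ∀ i, Measurable (g i)) (hf : iIndepFun f P) (hg : iIndepFun g P)
    (hfg : IndepFun (fun ω i => f i ω) (fun ω i => g i ω) P) :
    iIndepFun (fun i ω => (f i ω, g i ω)) P := by
  -- Rectangles form a π-system generating each paired σ-algebra, so independence need only be
  -- checked on them.
  let π : ι → Set (Set Ω) := fun i => {s | ∃ a b, MeasurableSet a ∧ MeasurableSet b ∧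
      s = f i ⁻¹' a ∩ g i ⁻¹' b}
  refine iIndepSets.iIndep (m := fun i => MeasurableSpace.comap (fun ω => (f i ω, g i ω)) inferInstance)
    (fun i => ((hfm i).prodMk (hgm i)).comap_le) π ?_ ?_ ?_
  · rintro i _ ⟨a, b, ha, hb, rfl⟩ _ ⟨a', b', ha', hb', rfl⟩ _
    exact ⟨a ∩ a', b ∩ b', ha.inter ha', hb.inter hb', by
      simp only [preimage_inter]; ac_rfl⟩
  · intro i
    rw [← generateFrom_prod, MeasurableSpace.comap_generateFrom]
    congr 1
    ext s
    simp only [π, mem_image, mem_image2, mem_ofPred_eq]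
    constructor
    · rintro ⟨_, ⟨a, ha, b, hb, rfl⟩, rfl⟩
      exact ⟨a, b, ha, hb, rfl⟩
    · rintro ⟨a, b, ha, hb, rfl⟩
      exact ⟨_, ⟨a, ha, b, hb, rfl⟩, rfl⟩
  · rw [iIndepSets_iff]
    intro s A hA
    choose! a b ha hb hab using hA
    have h1 : ⋂ i ∈ s, A i = (fun ω i => f i ω) ⁻¹' (Set.pi s a) ∩
        (fun ω i => g i ω) ⁻¹' (Set.pi s b) := by
      ext ω
      simp only [mem_iInter, mem_inter_iff, mem_preimage, Set.mem_pi, Finset.mem_coe]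
      constructor
      · intro h
        exact ⟨fun i hi => by have := h i hi; rw [hab i hi] at this; exact this.1,
          fun i hi => by have := h i hi; rw [hab i hi] at this; exact this.2⟩
      · rintro ⟨h1, h2⟩ i hi
        rw [hab i hi]
        exact ⟨h1 i hi, h2 i hi⟩
    have hpa : (fun ω i => f i ω) ⁻¹' (Set.pi s a) = ⋂ i ∈ s, f i ⁻¹' a i := by ext ω; simp
    have hpb : (fun ω i => g i ω) ⁻¹' (Set.pi s b) = ⋂ i ∈ s, g i ⁻¹' b i := by ext ω; simp
    rw [h1, hfg.measure_inter_preimage_eq_mul _ _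
      (MeasurableSet.pi s.countable_toSet fun i hi => ha i hi)
      (MeasurableSet.pi s.countable_toSet fun i hi => hb i hi), hpa, hpb,
      hf.measure_inter_preimage_eq_mul s ha, hg.measure_inter_preimage_eq_mul s hb,
      ← Finset.prod_mul_distrib]
    refine Finset.prod_congr rfl fun i hi => ?_
    rw [hab i hi]
    have : IndepFun (f i) (g i) P :=
      hfg.comp (measurable_pi_apply i) (measurable_pi_apply i)
    rw [this.measure_inter_preimage_eq_mul _ _ (ha i hi) (hb i hi)]

end Combine

/-! ### Rayleigh fading -/

section Fading

lemma lintegral_expNeg_sq_gaussianReal {s : ℝ} (hs : 0 ≤ s) :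
    ∫⁻ x, expNeg (ENNReal.ofReal (s * x ^ 2)) ∂(gaussianReal 0 (1 / 2)) =
      ENNReal.ofReal (√(1 / (1 + s))) := by
  have h1 : ∀ x : ℝ, expNeg (ENNReal.ofReal (s * x ^ 2)) =
      ENNReal.ofReal (Real.exp (-(s * x ^ 2))) := fun x => expNeg_ofReal (by positivity)
  have hint : Integrable (fun x : ℝ => Real.exp (-(s * x ^ 2))) (gaussianReal 0 (1 / 2)) := by
    refine (integrable_const (1 : ℝ)).mono' (by fun_prop) (Eventually.of_forall fun x => ?_)
    rw [Real.norm_eq_abs, abs_of_pos (Real.exp_pos _), Real.exp_le_one_iff]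
    nlinarith [mul_nonneg hs (sq_nonneg x)]
  simp_rw [h1]
  rw [← ofReal_integral_eq_lintegral_ofReal hint
    (Eventually.of_forall fun x => (Real.exp_pos _).le),
    integral_gaussianReal_eq_integral_smul (by norm_num)]
  congr 1
  have h2 : ∀ x : ℝ, gaussianPDFReal 0 (1 / 2) x • Real.exp (-(s * x ^ 2)) =
      (√Real.pi)⁻¹ * Real.exp (-(1 + s) * x ^ 2) := by
    intro x
    rw [gaussianPDFReal, smul_eq_mul, mul_assoc, ← Real.exp_add]
    congr 3
    · push_cast; ring
    · push_cast; ring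
  simp_rw [h2]
  rw [integral_const_mul, integral_gaussian, ← Real.sqrt_inv, ← Real.sqrt_mul (by positivity)]
  congr 1
  field_simp

instance : IsProbabilityMeasure complexGaussian :=
  Measure.isProbabilityMeasure_map (by
    refine Measurable.aemeasurable ?_
    exact Complex.measurableEquivRealProd.symm.measurable)

/-- The squared modulus of a circularly symmetric complex Gaussian variable is exponential. -/
lemma lintegral_expNeg_complexGaussian {s : ℝ} (hs : 0 ≤ s) :
    ∫⁻ h, expNeg (ENNReal.ofReal (s * ‖h‖ ^ 2)) ∂complexGaussian =
      ENNReal.ofReal (1 / (1 + s)) := by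
  have hm : Measurable fun p : ℝ × ℝ => (⟨p.1, p.2⟩ : ℂ) :=
    Complex.measurableEquivRealProd.symm.measurable
  rw [complexGaussian, lintegral_map (by fun_prop) hm]
  have h1 : ∀ p : ℝ × ℝ, expNeg (ENNReal.ofReal (s * ‖(⟨p.1, p.2⟩ : ℂ)‖ ^ 2)) =
      expNeg (ENNReal.ofReal (s * p.1 ^ 2)) * expNeg (ENNReal.ofReal (s * p.2 ^ 2)) := by
    intro p
    rw [← expNeg_add, ← ENNReal.ofReal_add (by positivity) (by positivity), Complex.sq_norm,
      Complex.normSq_mk]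
    congr 2; ring
  simp_rw [h1]
  rw [lintegral_prod_mul (f := fun x : ℝ => expNeg (ENNReal.ofReal (s * x ^ 2)))
    (g := fun x : ℝ => expNeg (ENNReal.ofReal (s * x ^ 2))) (by fun_prop) (by fun_prop), lintegral_expNeg_sq_gaussianReal hs,
    ← ENNReal.ofReal_mul (by positivity), Real.mul_self_sqrt (by positivity)]

end Fading

/-! ### Attenuation, and the Laplace transform of the power of one cluster -/

/-- The factor `tγ / (‖z‖ ^ α + tγ)` by which a transmitter at `z` reduces the Laplace transform. -/
noncomputable def attenuation (α γ : ℝ) (t : ℝ≥0) (z : Plane) : ℝ≥0∞ :=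
  ENNReal.ofReal (t * γ / (‖z‖ ^ α + t * γ))

/-- The mean attenuation due to a transmitter of a cluster centered at `z`. -/
noncomputable def clusterLoss (α γ σ : ℝ) (t : ℝ≥0) (z : Plane) : ℝ≥0∞ :=
  ∫⁻ y, attenuation α γ t (z + y) ∂(planarGaussian σ)

/-- The Laplace transform at `t` of the interference from all clusters. -/
noncomputable def networkLaplace (lam nbar : ℝ≥0) (α γ σ : ℝ) (t : ℝ≥0) : ℝ≥0∞ :=
  expNeg (∫⁻ z, (1 - expNeg (nbar * clusterLoss α γ σ t z)) ∂(lam • (volume : Measure Plane)))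

/-- Marks of a cluster: its size and, for each device, displacement, caching status and fading
coefficient. -/
abbrev ClusterMark : Type := ℕ × (ℕ → Plane × Bool × ℂ)

/-- The power received at the origin from the devices of a cluster centered at `z`. -/
noncomputable def ClusterMark.power (α γ : ℝ) (m : ClusterMark) (z : Plane) : ℝ≥0∞ :=
  ∑ l ∈ Finset.range m.1,
    ENNReal.ofReal (γ * ‖(m.2 l).2.2‖ ^ 2) * ENNReal.ofReal ‖z + (m.2 l).1‖ ^ (-α)

/-- The law of the marks of a cluster, where `β` is the law of the caching status. -/
noncomputable def markLaw (nbar : ℝ≥0) (σ : ℝ) (β : Measure Bool) : Measure ClusterMark :=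
  (poissonMeasure nbar).prod
    (Measure.infinitePi fun _ : ℕ => (planarGaussian σ).prod (β.prod complexGaussian))

variable {α γ σ : ℝ} {t : ℝ≥0}

@[fun_prop]
lemma Measurable.attenuation {δ : Type*} [MeasurableSpace δ] {f : δ → ℝ≥0} {g : δ → Plane}
    (hf : Measurable f) (hg : Measurable g) :
    Measurable fun x => attenuation α γ (f x) (g x) := by
  unfold _root_.attenuation
  fun_prop

lemma attenuation_le_one (hγ : 0 < γ) (z : Plane) : attenuation α γ t z ≤ 1 := by
  rw [attenuation, ENNReal.ofReal_le_one]
  refine div_le_one_of_le₀ ?_ (by positivity)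
  have : 0 ≤ ‖z‖ ^ α := by positivity
  linarith

lemma attenuation_mono (hγ : 0 < γ) (z : Plane) : Monotone fun t => attenuation α γ t z := by
  intro s t hst
  refine ENNReal.ofReal_le_ofReal ?_
  have hst' : (s : ℝ) ≤ t := hst
  have h0 : 0 ≤ ‖z‖ ^ α := by positivity
  rcases eq_or_lt_of_le (show (0 : ℝ) ≤ s from s.2) with hs | hs
  · rw [← hs]; simp only [zero_mul, zero_div]; positivity
  rw [div_le_div_iff₀ (by positivity) (by have := hs.trans_le hst'; positivity)]
  have := mul_le_mul_of_nonneg_right hst' (mul_nonneg hγ.le h0)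
  nlinarith

lemma continuous_attenuation (hγ : 0 < γ) (hα : 0 < α) : Continuous (attenuation α γ t) := by
  rcases eq_or_ne t 0 with rfl | ht
  · have : attenuation α γ 0 = fun _ => 0 := by ext z; simp [attenuation]
    rw [this]; exact continuous_const
  · have ht' : (0 : ℝ) < t := by positivity
    refine ENNReal.continuous_ofReal.comp (continuous_const.div ?_ fun z => ?_)
    · exact (continuous_norm.rpow_const fun _ => Or.inr hα.le).add continuous_const
    · have : 0 ≤ ‖z‖ ^ α := by positivity
      positivity

/-- The attenuation is at most a constant times (1 + ‖z‖)^{-α}, integrable in dimension 2 because α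
> 2. The constant comes from (1 + r)^α ≤ 2^α(1 + r^α). -/
lemma lintegral_attenuation_lt_top (hγ : 0 < γ) (hα : 2 < α) (t : ℝ≥0) :
    ∫⁻ z, attenuation α γ t z < ∞ := by
  have hint : Integrable (fun z : Plane => 2 ^ α * (1 + t * γ) * (1 + ‖z‖) ^ (-α)) :=
    (integrable_one_add_norm (by simpa using hα)).const_mul _
  refine (lintegral_mono fun z => ENNReal.ofReal_le_ofReal ?_).trans_lt
    hint.lintegral_lt_top
  have h0 : 0 ≤ ‖z‖ ^ α := by positivity
  have htγ : 0 ≤ t * γ := by positivity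
  have hpow : (1 + ‖z‖) ^ α ≤ 2 ^ α * (1 + ‖z‖ ^ α) := by
    rcases le_total ‖z‖ 1 with h | h
    · calc (1 + ‖z‖) ^ α ≤ 2 ^ α := by
            refine Real.rpow_le_rpow (by positivity) (by linarith) (by linarith)
        _ ≤ 2 ^ α * (1 + ‖z‖ ^ α) := le_mul_of_one_le_right (by positivity) (by linarith)
    · calc (1 + ‖z‖) ^ α ≤ (2 * ‖z‖) ^ α :=
            Real.rpow_le_rpow (by positivity) (by linarith) (by linarith)
        _ = 2 ^ α * ‖z‖ ^ α := Real.mul_rpow (by norm_num) (norm_nonneg _)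
        _ ≤ 2 ^ α * (1 + ‖z‖ ^ α) := by gcongr; linarith
  rcases eq_or_lt_of_le htγ with h | h
  · rw [← h]; simp only [zero_div]; positivity
  rw [Real.rpow_neg (by positivity), ← div_eq_mul_inv, div_le_div_iff₀ (by positivity) (by positivity)]
  calc t * γ * (1 + ‖z‖) ^ α ≤ t * γ * (2 ^ α * (1 + ‖z‖ ^ α)) := by gcongr
    _ = 2 ^ α * (t * γ * ‖z‖ ^ α + t * γ) := by ring
    _ ≤ 2 ^ α * ((1 + t * γ) * (‖z‖ ^ α + t * γ)) := by gcongr; nlinarith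
    _ = _ := by ring

lemma tendsto_lintegral_attenuation (hγ : 0 < γ) (hα : 2 < α) :
    Tendsto (fun n : ℕ => ∫⁻ z, attenuation α γ (1 / (n + 1)) z) atTop (𝓝 0) := by
  have h := tendsto_lintegral_of_dominated_convergence (μ := (volume : Measure Plane))
    (F := fun n : ℕ => attenuation α γ (1 / (n + 1))) (f := fun _ => 0) (attenuation α γ 1)
    (fun n => by fun_prop)
    (fun n => Eventually.of_forall fun z => attenuation_mono hγ z ?_)
    (lintegral_attenuation_lt_top hγ hα 1).ne ?_
  · simpa using h
  · rw [div_le_one₀ (by positivity)]; simp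
  -- The origin must be removed: there the attenuation equals 1 for every positive argument.
  · filter_upwards [compl_mem_ae_iff.2 (measure_singleton (0 : Plane))] with z hz
    have hz' : 0 < ‖z‖ := norm_pos_iff.2 hz
    have h1 : Tendsto (fun n : ℕ => 1 / (n + 1 : ℝ)) atTop (𝓝 0) :=
      tendsto_one_div_add_atTop_nhds_zero_nat
    have h2 : Tendsto (fun n : ℕ => 1 / (n + 1 : ℝ) * γ / (‖z‖ ^ α + 1 / (n + 1 : ℝ) * γ))
        atTop (𝓝 (0 * γ / (‖z‖ ^ α + 0 * γ))) := by
      refine (h1.mul_const γ).div (tendsto_const_nhds.add (h1.mul_const γ)) ?_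
      have : 0 < ‖z‖ ^ α := by positivity
      simpa using this.ne'
    have h3 := (ENNReal.continuous_ofReal.tendsto _).comp h2
    simp only [zero_mul, zero_div, ENNReal.ofReal_zero] at h3
    refine h3.congr fun n => ?_
    simp [attenuation]

lemma measurable_clusterLoss_uncurry [IsProbabilityMeasure (planarGaussian σ)] :
    Measurable fun p : ℝ≥0 × Plane => clusterLoss α γ σ p.1 p.2 := by
  refine Measurable.lintegral_prod_right' (f := fun p : (ℝ≥0 × Plane) × Plane =>
    attenuation α γ p.1.1 (p.1.2 + p.2)) ?_
  fun_prop

@[fun_prop]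
lemma Measurable.clusterLoss [IsProbabilityMeasure (planarGaussian σ)] {δ : Type*}
    [MeasurableSpace δ] {f : δ → ℝ≥0} {g : δ → Plane} (hf : Measurable f) (hg : Measurable g) :
    Measurable fun x => clusterLoss α γ σ (f x) (g x) :=
  measurable_clusterLoss_uncurry.comp (hf.prodMk hg)

lemma clusterLoss_le_one [IsProbabilityMeasure (planarGaussian σ)] (hγ : 0 < γ) (z : Plane) :
    clusterLoss α γ σ t z ≤ 1 :=
  (lintegral_mono fun _ => attenuation_le_one hγ _).trans (by simp)

/-- Continuity is what the recentered Mecke formula requires of its test function. -/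
lemma continuous_clusterLoss [IsProbabilityMeasure (planarGaussian σ)] (hγ : 0 < γ) (hα : 0 < α) :
    Continuous (clusterLoss α γ σ t) := by
  refine continuous_iff_continuousAt.2 fun z => ?_
  refine tendsto_lintegral_filter_of_dominated_convergence (fun _ => 1)
    (Eventually.of_forall fun x => ?_) (Eventually.of_forall fun x =>
      Eventually.of_forall fun y => attenuation_le_one hγ _) (by simp)
    (Eventually.of_forall fun y => ?_)
  · exact ((continuous_attenuation hγ hα).comp (by fun_prop)).measurable
  · exact ((continuous_attenuation hγ hα).comp (by fun_prop)).tendsto z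

/-- By Tonelli and translation invariance, averaging over the displacement preserves the total
integral. -/
lemma lintegral_clusterLoss [IsProbabilityMeasure (planarGaussian σ)] :
    ∫⁻ z, clusterLoss α γ σ t z = ∫⁻ z, attenuation α γ t z := by
  unfold clusterLoss
  rw [lintegral_lintegral_swap (by fun_prop)]
  simp_rw [lintegral_add_right_eq_self]
  simp

section Laplace

variable {lam nbar : ℝ≥0}

lemma measurable_networkLaplace [IsProbabilityMeasure (planarGaussian σ)] :
    Measurable (networkLaplace lam nbar α γ σ) := by
  refine measurable_expNeg.comp (Measurable.lintegral_prod_right' (f := fun p : ℝ≥0 × Plane =>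
    1 - expNeg (nbar * clusterLoss α γ σ p.1 p.2)) ?_)
  fun_prop

lemma lintegral_one_sub_expNeg_clusterLoss_le [IsProbabilityMeasure (planarGaussian σ)] :
    ∫⁻ z, (1 - expNeg (nbar * clusterLoss α γ σ t z)) ≤
      nbar * ∫⁻ z, attenuation α γ t z := by
  rw [← lintegral_clusterLoss (σ := σ), ← lintegral_const_mul]
  · exact lintegral_mono fun z => one_sub_expNeg_le _
  · fun_prop

lemma tendsto_networkLaplace [IsProbabilityMeasure (planarGaussian σ)] (hγ : 0 < γ) (hα : 2 < α) :
    Tendsto (fun n : ℕ => networkLaplace lam nbar α γ σ (1 / (n + 1))) atTop (𝓝 1) := by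
  have h1 : Tendsto (fun n : ℕ => expNeg (lam * (nbar * ∫⁻ z, attenuation α γ (1 / (n + 1)) z)))
      atTop (𝓝 1) := by
    have h := tendsto_lintegral_attenuation hγ hα
    have h' := ENNReal.Tendsto.const_mul (a := (lam : ℝ≥0∞)) (ENNReal.Tendsto.const_mul
      (a := (nbar : ℝ≥0∞)) h (Or.inr ENNReal.coe_ne_top)) (Or.inr ENNReal.coe_ne_top)
    rw [mul_zero, mul_zero] at h'
    have h2 := (continuous_expNeg.tendsto 0).comp h'
    rwa [expNeg_zero] at h2
  refine tendsto_of_tendsto_of_tendsto_of_le_of_le h1 tendsto_const_nhds (fun n => ?_)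
    (fun n => expNeg_le_one _)
  refine antitone_expNeg ?_
  rw [lintegral_smul_measure]
  exact mul_le_mul' le_rfl lintegral_one_sub_expNeg_clusterLoss_le

end Laplace

/-- The index set no longer depends on the mark, so measurability can be checked term by term. -/
lemma ClusterMark.power_eq_tsum (m : ClusterMark) (z : Plane) :
    m.power α γ z = ∑' l, if l < m.1 then
      ENNReal.ofReal (γ * ‖(m.2 l).2.2‖ ^ 2) * ENNReal.ofReal ‖z + (m.2 l).1‖ ^ (-α) else 0 := by
  rw [tsum_eq_sum (s := Finset.range m.1)]
  · refine Finset.sum_congr rfl fun l hl => ?_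
    rw [if_pos (Finset.mem_range.1 hl)]
  · intro l hl
    rw [if_neg (by simpa using hl)]

lemma measurable_power_uncurry : Measurable fun p : ClusterMark × Plane => p.1.power α γ p.2 := by
  simp_rw [ClusterMark.power_eq_tsum]
  refine Measurable.tsum fun l => Measurable.ite ?_ (by fun_prop) measurable_const
  exact measurableSet_lt measurable_const (by fun_prop)

@[fun_prop]
lemma measurable_power {δ : Type*} [MeasurableSpace δ] {f : δ → ClusterMark} {g : δ → Plane}
    (hf : Measurable f) (hg : Measurable g) : Measurable fun x => ClusterMark.power α γ (f x) (g x) := by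
  have := (measurable_power_uncurry (α := α) (γ := γ)).comp (hf.prodMk hg)
  exact this

/-- The squared fading modulus is exponential of mean 1, giving 1/(1 + tγ‖z‖^{-α}), which equals 1 -
tγ/(‖z‖^α + tγ). -/
lemma lintegral_expNeg_fading (hγ : 0 < γ) {z : Plane} (hz : z ≠ 0) :
    ∫⁻ h, expNeg (t * (ENNReal.ofReal (γ * ‖h‖ ^ 2) * ENNReal.ofReal ‖z‖ ^ (-α)))
      ∂complexGaussian = 1 - attenuation α γ t z := by
  have hz' : 0 < ‖z‖ := norm_pos_iff.2 hz
  have hp : 0 < ‖z‖ ^ α := by positivity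
  have hs : 0 ≤ t * γ * ‖z‖ ^ (-α) := by positivity
  have h1 : ∀ h : ℂ, (t : ℝ≥0∞) * (ENNReal.ofReal (γ * ‖h‖ ^ 2) * ENNReal.ofReal ‖z‖ ^ (-α)) =
      ENNReal.ofReal (t * γ * ‖z‖ ^ (-α) * ‖h‖ ^ 2) := by
    intro h
    rw [ENNReal.ofReal_rpow_of_pos hz', ← ENNReal.ofReal_mul (by positivity),
      ← ENNReal.ofReal_coe_nnreal, ← ENNReal.ofReal_mul (by positivity)]
    congr 1; ring
  simp_rw [h1]
  rw [lintegral_expNeg_complexGaussian hs, attenuation, ← ENNReal.ofReal_one,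
    ← ENNReal.ofReal_sub _ (by positivity), Real.rpow_neg hz'.le]
  congr 1
  field_simp
  ring

lemma ae_add_ne_zero (z : Plane) : ∀ᵐ y ∂(planarGaussian σ), z + y ≠ 0 := by
  refine (withDensity_absolutelyContinuous _ _).ae_le ?_
  filter_upwards [compl_mem_ae_iff.2 (measure_singleton (-z))] with y hy h
  exact hy (by rw [mem_singleton_iff]; exact (neg_eq_of_add_eq_zero_right h).symm)

instance {nbar : ℝ≥0} {β : Measure Bool} [IsProbabilityMeasure (planarGaussian σ)]
    [IsProbabilityMeasure β] : IsProbabilityMeasure (markLaw nbar σ β) := by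
  unfold markLaw; infer_instance

lemma lintegral_expNeg_device {β : Measure Bool} [IsProbabilityMeasure (planarGaussian σ)]
    [IsProbabilityMeasure β] (hγ : 0 < γ) (z : Plane) :
    ∫⁻ r : Plane × Bool × ℂ,
        expNeg (t * (ENNReal.ofReal (γ * ‖r.2.2‖ ^ 2) * ENNReal.ofReal ‖z + r.1‖ ^ (-α)))
      ∂((planarGaussian σ).prod (β.prod complexGaussian)) = 1 - clusterLoss α γ σ t z := by
  rw [lintegral_prod _ (by fun_prop)]
  have h1 : ∀ y : Plane, ∫⁻ s : Bool × ℂ,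
      expNeg (t * (ENNReal.ofReal (γ * ‖s.2‖ ^ 2) * ENNReal.ofReal ‖z + y‖ ^ (-α)))
        ∂(β.prod complexGaussian) = ∫⁻ h,
      expNeg (t * (ENNReal.ofReal (γ * ‖h‖ ^ 2) * ENNReal.ofReal ‖z + y‖ ^ (-α)))
        ∂complexGaussian := by
    intro y
    rw [lintegral_prod _ (by fun_prop)]
    simp only [lintegral_const, measure_univ, mul_one]
  simp_rw [h1]
  have h2 : ∫⁻ y, ∫⁻ h,
      expNeg (t * (ENNReal.ofReal (γ * ‖h‖ ^ 2) * ENNReal.ofReal ‖z + y‖ ^ (-α)))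
        ∂complexGaussian ∂(planarGaussian σ) =
      ∫⁻ y, (1 - attenuation α γ t (z + y)) ∂(planarGaussian σ) := by
    refine lintegral_congr_ae ?_
    filter_upwards [ae_add_ne_zero z] with y hy
    exact lintegral_expNeg_fading (α := α) (t := t) hγ hy
  rw [h2, lintegral_sub (by fun_prop)
    (ne_top_of_le_ne_top ENNReal.one_ne_top (clusterLoss_le_one hγ z))
    (Eventually.of_forall fun y => attenuation_le_one hγ _)]
  simp [clusterLoss]

/-- The Laplace transform of the power received from one cluster. -/
lemma lintegral_expNeg_power {nbar : ℝ≥0} {β : Measure Bool}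
    [IsProbabilityMeasure (planarGaussian σ)] [IsProbabilityMeasure β] (hγ : 0 < γ) (z : Plane) :
    ∫⁻ m, expNeg (t * m.power α γ z) ∂(markLaw nbar σ β) =
      expNeg (nbar * clusterLoss α γ σ t z) := by
  have hmeas : Measurable fun m : ClusterMark => expNeg (t * m.power α γ z) := by fun_prop
  rw [markLaw, lintegral_prod _ hmeas.aemeasurable]
  -- Given the size n, the devices are i.i.d. and contribute an n-th power; the Poisson generating
  -- function then sums over n.
  have h3 : ∀ n : ℕ, ∫⁻ r : ℕ → Plane × Bool × ℂ, expNeg (t * ClusterMark.power α γ (n, r) z)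
      ∂(Measure.infinitePi fun _ : ℕ => (planarGaussian σ).prod (β.prod complexGaussian)) =
        (1 - clusterLoss α γ σ t z) ^ n := by
    intro n
    simp_rw [ClusterMark.power, Finset.mul_sum, expNeg_sum]
    rw [lintegral_infinitePi_prod (E := fun _ : ℕ => Plane × Bool × ℂ) _ _
      (g := fun _ (r : Plane × Bool × ℂ) => expNeg (t * (ENNReal.ofReal (γ * ‖r.2.2‖ ^ 2) *
        ENNReal.ofReal ‖z + r.1‖ ^ (-α)))) fun _ => by fun_prop]
    rw [Finset.prod_const, Finset.card_range, lintegral_expNeg_device hγ]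
  simp_rw [h3]
  rw [lintegral_pow_poissonMeasure _ tsub_le_self,
    ENNReal.sub_sub_cancel ENNReal.one_ne_top (clusterLoss_le_one hγ z)]

/-! ### Polar coordinates: the Rice density and the closed formula -/

/-- Periodicity removes the phase θ₀, and evenness folds the circle onto [0, π]. -/
lemma integral_exp_mul_cos_sub (a θ₀ : ℝ) :
    ∫ θ in (-Real.pi)..Real.pi, Real.exp (a * Real.cos (θ - θ₀)) = 2 * Real.pi * besselI0 a := by
  set f : ℝ → ℝ := fun θ => Real.exp (a * Real.cos θ) with hf
  have hfc : Continuous f := by fun_prop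
  have hper : Function.Periodic f (2 * Real.pi) := fun θ => by simp [hf]
  have h1 : ∫ θ in (-Real.pi)..Real.pi, f (θ - θ₀) = ∫ θ in (-Real.pi)..Real.pi, f θ := by
    rw [intervalIntegral.integral_comp_sub_right f θ₀]
    have := hper.intervalIntegral_add_eq (-Real.pi - θ₀) (-Real.pi)
    convert! this using 2 <;> ring
  have h2 : ∫ θ in (-Real.pi)..0, f θ = ∫ θ in (0 : ℝ)..Real.pi, f θ := by
    have := intervalIntegral.integral_comp_neg (a := 0) (b := Real.pi) f
    rw [neg_zero] at this
    rw [← this]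
    exact intervalIntegral.integral_congr fun θ _ => by simp [hf]
  rw [h1, ← intervalIntegral.integral_add_adjacent_intervals (b := 0)
    (hfc.intervalIntegrable _ _) (hfc.intervalIntegrable _ _), h2, besselI0]
  have := Real.pi_pos
  field_simp
  ring

lemma besselI0_nonneg (a : ℝ) : 0 ≤ besselI0 a := by
  refine mul_nonneg (by positivity) ?_
  exact intervalIntegral.integral_nonneg Real.pi_pos.le fun θ _ => (Real.exp_pos _).le

lemma ricePDF_nonneg {u : ℝ} (hu : 0 ≤ u) (v σ : ℝ) : 0 ≤ ricePDF u v σ :=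
  mul_nonneg (by positivity) (besselI0_nonneg _)

lemma continuous_besselI0 : Continuous besselI0 := by
  unfold besselI0
  refine continuous_const.mul ?_
  exact intervalIntegral.continuous_parametric_intervalIntegral_of_continuous' (by fun_prop) _ _

lemma continuous_ricePDF (v σ : ℝ) : Continuous fun u => ricePDF u v σ := by
  unfold ricePDF
  have := continuous_besselI0
  fun_prop

/-- The distance to the origin of a planar Gaussian vector centered at `z` has the Rice density. -/
lemma lintegral_norm_planarGaussian {σ : ℝ} (hσ : 0 < σ) {ψ : ℝ → ℝ≥0∞} (hψ : Measurable ψ)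
    (z : Plane) :
    ∫⁻ y, ψ ‖z + y‖ ∂(planarGaussian σ) =
      ∫⁻ u in Ioi 0, ψ u * ENNReal.ofReal (ricePDF u ‖z‖ σ) := by
  let G : ℝ → ℝ≥0∞ := fun r =>
    ENNReal.ofReal (1 / (2 * Real.pi * σ ^ 2) * Real.exp (-r ^ 2 / (2 * σ ^ 2)))
  have hG : Measurable G := by fun_prop
  -- The plane is identified with ℂ isometrically; the argument θ₀ of the center becomes the phase
  -- in the angular integral.
  set e := Complex.orthonormalBasisOneI.repr with he
  set ζ : ℂ := e.symm z with hζ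
  have hζn : ‖ζ‖ = ‖z‖ := e.symm.norm_map z
  set θ₀ := ζ.arg with hθ₀
  have hre : ζ.re = ‖z‖ * Real.cos θ₀ := by rw [← hζn, hθ₀, Complex.norm_mul_cos_arg]
  have him : ζ.im = ‖z‖ * Real.sin θ₀ := by rw [← hζn, hθ₀, Complex.norm_mul_sin_arg]
  have h1 : ∫⁻ y, ψ ‖z + y‖ ∂(planarGaussian σ) = ∫⁻ w : Plane, G ‖w - z‖ * ψ ‖w‖ := by
    rw [planarGaussian, lintegral_withDensity_eq_lintegral_mul _ (by fun_prop) (by fun_prop),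
      ← lintegral_add_left_eq_self (fun w : Plane => G ‖w - z‖ * ψ ‖w‖) z]
    refine lintegral_congr fun y => ?_
    simp [G]
  have h2 : ∫⁻ w : Plane, G ‖w - z‖ * ψ ‖w‖ = ∫⁻ c : ℂ, G ‖c - ζ‖ * ψ ‖c‖ := by
    rw [← e.measurePreserving.lintegral_comp (by fun_prop)]
    refine lintegral_congr fun c => ?_
    have h3 : e c - z = e (c - ζ) := by rw [map_sub, hζ, e.apply_symm_apply]
    rw [h3, e.norm_map, e.norm_map]
  rw [h1, h2, ← Complex.lintegral_comp_polarCoord_symm, polarCoord_target]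
  have h4 : ∫⁻ p in Ioi (0 : ℝ) ×ˢ Ioo (-Real.pi) Real.pi, ENNReal.ofReal p.1 •
      (G ‖Complex.polarCoord.symm p - ζ‖ * ψ ‖Complex.polarCoord.symm p‖) =
      ∫⁻ p in Ioi (0 : ℝ) ×ˢ Ioo (-Real.pi) Real.pi, ψ p.1 * ENNReal.ofReal
        (p.1 / (2 * Real.pi * σ ^ 2) * Real.exp (-(p.1 ^ 2 + ‖z‖ ^ 2) / (2 * σ ^ 2)) *
          Real.exp (p.1 * ‖z‖ / σ ^ 2 * Real.cos (p.2 - θ₀))) := by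
    refine setLIntegral_congr_fun (measurableSet_Ioi.prod measurableSet_Ioo) fun p hp => ?_
    have hp1 : 0 < p.1 := hp.1
    -- The law of cosines splits the Gaussian into a radial factor and exp(u‖z‖ cos(θ - θ₀)/σ²),
    -- whose angular integral is 2π I₀.
    have hnorm : ‖Complex.polarCoord.symm p - ζ‖ ^ 2 =
        p.1 ^ 2 + ‖z‖ ^ 2 - 2 * p.1 * ‖z‖ * Real.cos (p.2 - θ₀) := by
      rw [Complex.sq_norm, Complex.normSq_apply, Complex.polarCoord_symm_apply, Real.cos_sub]
      simp only [Complex.sub_re, Complex.sub_im, hre, him, Complex.mul_re, Complex.mul_im,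
        Complex.ofReal_re, Complex.ofReal_im, Complex.add_re, Complex.add_im, Complex.I_re,
        Complex.I_im]
      linear_combination p.1 ^ 2 * Real.sin_sq_add_cos_sq p.2 +
        ‖z‖ ^ 2 * Real.sin_sq_add_cos_sq θ₀
    simp only [G]
    rw [Complex.norm_polarCoord_symm, abs_of_pos hp1, hnorm, smul_eq_mul, ← mul_assoc,
      ← ENNReal.ofReal_mul hp1.le, mul_comm]
    congr 2
    rw [mul_assoc (p.1 / _), ← Real.exp_add, ← mul_assoc, mul_one_div]
    congr 2
    field_simp
    ring
  rw [h4, Measure.volume_eq_prod, ← Measure.prod_restrict, lintegral_prod _ (by fun_prop)]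
  refine setLIntegral_congr_fun measurableSet_Ioi fun u hu => ?_
  have hu' : 0 < u := hu
  simp only
  rw [lintegral_const_mul _ (by fun_prop)]
  congr 1
  have hcont : Continuous fun θ : ℝ => u / (2 * Real.pi * σ ^ 2) *
      Real.exp (-(u ^ 2 + ‖z‖ ^ 2) / (2 * σ ^ 2)) *
        Real.exp (u * ‖z‖ / σ ^ 2 * Real.cos (θ - θ₀)) := by fun_prop
  have hle : -Real.pi ≤ Real.pi := by linarith [Real.pi_pos]
  rw [← ofReal_integral_eq_lintegral_ofReal
    ((hcont.integrableOn_Icc).mono_set Ioo_subset_Icc_self)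
    (Eventually.of_forall fun θ => by positivity), ← integral_Ioc_eq_integral_Ioo,
    ← intervalIntegral.integral_of_le hle, intervalIntegral.integral_const_mul,
    integral_exp_mul_cos_sub, ricePDF]
  congr 1
  have := Real.pi_pos
  field_simp

section

variable {α γ σ : ℝ} {t : ℝ≥0}

lemma clusterLoss_eq_lintegral_rice (hγ : 0 < γ) (hσ : 0 < σ) (z : Plane) :
    clusterLoss α γ σ t z =
      ∫⁻ u in Ioi 0, ENNReal.ofReal (t * γ / (u ^ α + t * γ) * ricePDF u ‖z‖ σ) := by
  refine (lintegral_norm_planarGaussian hσ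
    (ψ := fun u => ENNReal.ofReal (t * γ / (u ^ α + t * γ))) (by fun_prop) z).trans ?_
  refine setLIntegral_congr_fun measurableSet_Ioi fun u hu => ?_
  have hu' : 0 < u := hu
  exact (ENNReal.ofReal_mul (by positivity)).symm

/-- No tail estimate for I₀ is needed: the integral is `clusterLoss`, which is at most 1. -/
lemma integrableOn_rice [IsProbabilityMeasure (planarGaussian σ)] (hγ : 0 < γ) (hσ : 0 < σ)
    (z : Plane) :
    IntegrableOn (fun u => t * γ / (u ^ α + t * γ) * ricePDF u ‖z‖ σ) (Ioi 0) := by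
  have hm : Measurable fun u => t * γ / (u ^ α + t * γ) * ricePDF u ‖z‖ σ := by
    have := (continuous_ricePDF ‖z‖ σ).measurable
    fun_prop
  refine ⟨hm.aestronglyMeasurable, ?_⟩
  rw [hasFiniteIntegral_iff_ofReal, ← clusterLoss_eq_lintegral_rice hγ hσ]
  · exact (clusterLoss_le_one hγ z).trans_lt ENNReal.one_lt_top
  · filter_upwards [ae_restrict_mem measurableSet_Ioi] with u hu
    have hu' : 0 < u := hu
    exact mul_nonneg (by positivity) (ricePDF_nonneg hu'.le _ _)

lemma zetaFn_nonneg (hγ : 0 < γ) (v : ℝ) : 0 ≤ zetaFn α γ σ v t := by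
  refine setIntegral_nonneg measurableSet_Ioi fun u hu => ?_
  have hu' : 0 < u := hu
  exact mul_nonneg (by positivity) (ricePDF_nonneg hu'.le _ _)

lemma clusterLoss_eq [IsProbabilityMeasure (planarGaussian σ)] (hγ : 0 < γ) (hσ : 0 < σ)
    (z : Plane) : clusterLoss α γ σ t z = ENNReal.ofReal (zetaFn α γ σ ‖z‖ t) := by
  rw [clusterLoss_eq_lintegral_rice hγ hσ, zetaFn, ofReal_integral_eq_lintegral_ofReal
    (integrableOn_rice hγ hσ z)]
  filter_upwards [ae_restrict_mem measurableSet_Ioi] with u hu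
  have hu' : 0 < u := hu
  exact mul_nonneg (by positivity) (ricePDF_nonneg hu'.le _ _)

variable {lam nbar : ℝ≥0}

lemma one_sub_expNeg_clusterLoss [IsProbabilityMeasure (planarGaussian σ)] (hγ : 0 < γ)
    (hσ : 0 < σ) (z : Plane) : 1 - expNeg (nbar * clusterLoss α γ σ t z) =
      ENNReal.ofReal (1 - Real.exp (-nbar * zetaFn α γ σ ‖z‖ t)) := by
  rw [clusterLoss_eq hγ hσ, ← ENNReal.ofReal_coe_nnreal, ← ENNReal.ofReal_mul (by positivity),
    expNeg_ofReal (mul_nonneg (by positivity) (zetaFn_nonneg hγ _)),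
    ENNReal.ofReal_sub _ (Real.exp_pos _).le, ENNReal.ofReal_one, neg_mul]

lemma one_sub_exp_zetaFn_nonneg (hγ : 0 < γ) (v : ℝ) :
    0 ≤ 1 - Real.exp (-nbar * zetaFn α γ σ v t) := by
  rw [sub_nonneg, Real.exp_le_one_iff, neg_mul, neg_nonpos]
  exact mul_nonneg (by positivity) (zetaFn_nonneg hγ _)

lemma integrable_one_sub_exp_zetaFn [IsProbabilityMeasure (planarGaussian σ)] (hγ : 0 < γ)
    (hσ : 0 < σ) (hα : 2 < α) :
    Integrable fun z : Plane => 1 - Real.exp (-nbar * zetaFn α γ σ ‖z‖ t) := by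
  have hm : Measurable fun z : Plane => 1 - Real.exp (-nbar * zetaFn α γ σ ‖z‖ t) := by
    -- Measurability in z is inherited from `clusterLoss`, a parametric `lintegral`.
    have h : (fun z : Plane => 1 - Real.exp (-nbar * zetaFn α γ σ ‖z‖ t)) = fun z =>
        (1 - expNeg (nbar * clusterLoss α γ σ t z)).toReal := by
      ext z
      rw [one_sub_expNeg_clusterLoss hγ hσ, ENNReal.toReal_ofReal (one_sub_exp_zetaFn_nonneg hγ _)]
    rw [h]
    fun_prop
  refine ⟨hm.aestronglyMeasurable, ?_⟩
  rw [hasFiniteIntegral_iff_ofReal (Eventually.of_forall fun z => one_sub_exp_zetaFn_nonneg hγ _)]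
  simp_rw [← one_sub_expNeg_clusterLoss hγ hσ]
  exact lintegral_one_sub_expNeg_clusterLoss_le.trans_lt
    (ENNReal.mul_lt_top ENNReal.coe_lt_top (lintegral_attenuation_lt_top hγ hα t))

lemma integrableOn_one_sub_exp_zetaFn [IsProbabilityMeasure (planarGaussian σ)] (hγ : 0 < γ)
    (hσ : 0 < σ) (hα : 2 < α) :
    IntegrableOn (fun v => (1 - Real.exp (-nbar * zetaFn α γ σ v t)) * v) (Ioi 0) := by
  have := (integrable_fun_norm_addHaar (volume : Measure Plane)
    (f := fun v => 1 - Real.exp (-nbar * zetaFn α γ σ v t))).1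
    (integrable_one_sub_exp_zetaFn hγ hσ hα)
  simpa [mul_comm] using this

lemma networkLaplace_eq [IsProbabilityMeasure (planarGaussian σ)] (hγ : 0 < γ)
    (hσ : 0 < σ) (hα : 2 < α) :
    networkLaplace lam nbar α γ σ t = ENNReal.ofReal (laplaceFormula lam nbar α γ σ t) := by
  have hint := integrable_one_sub_exp_zetaFn (α := α) (t := t) (nbar := nbar) hγ hσ hα
  have h0 : 0 ≤ ∫ z : Plane, (1 - Real.exp (-nbar * zetaFn α γ σ ‖z‖ t)) :=
    integral_nonneg fun z => one_sub_exp_zetaFn_nonneg hγ _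
  rw [networkLaplace, lintegral_smul_measure]
  simp_rw [one_sub_expNeg_clusterLoss hγ hσ]
  rw [← ofReal_integral_eq_lintegral_ofReal hint
    (Eventually.of_forall fun z => one_sub_exp_zetaFn_nonneg hγ _), ENNReal.smul_def, smul_eq_mul,
    ← ENNReal.ofReal_coe_nnreal, ← ENNReal.ofReal_mul (by positivity),
    expNeg_ofReal (mul_nonneg (by positivity) h0), laplaceFormula,
    integral_fun_norm_addHaar (volume : Measure Plane)
      (fun v => 1 - Real.exp (-nbar * zetaFn α γ σ v t))]
  congr 2
  -- The factor 2π in the formula is the dimension 2 times the area π of the unit disc.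
  have hball : (volume : Measure Plane).real (Metric.ball 0 1) = Real.pi := by
    rw [Measure.real, EuclideanSpace.volume_ball_fin_two]
    simp [Real.pi_pos.le]
  rw [hball]
  simp only [finrank_euclideanSpace, Fintype.card_fin, smul_eq_mul, Nat.add_one_sub_one, pow_one,
    nsmul_eq_mul, mul_comm (_ : ℝ) (1 - _)]
  push_cast
  ring

end

/-! ### Cluster marks and their joint law -/

lemma IndepFun.lintegral_comp_prodMk {Ω β β' : Type*} [MeasurableSpace Ω] [MeasurableSpace β]
    [MeasurableSpace β'] {P : Measure Ω} [IsProbabilityMeasure P] {X : Ω → β} {Y : Ω → β'}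
    (h : IndepFun X Y P) (hX : Measurable X) (hY : Measurable Y) {F : β × β' → ℝ≥0∞}
    (hF : Measurable F) :
    ∫⁻ ω, F (X ω, Y ω) ∂P = ∫⁻ ω, ∫⁻ y, F (X ω, y) ∂(P.map Y) ∂P := by
  have := Measure.isProbabilityMeasure_map (μ := P) hY.aemeasurable
  have := Measure.isProbabilityMeasure_map (μ := P) hX.aemeasurable
  rw [← lintegral_map hF (hX.prodMk hY),
    (indepFun_iff_map_prod_eq_prod_map_map hX.aemeasurable hY.aemeasurable).1 h,
    lintegral_prod _ hF.aemeasurable, lintegral_map hF.lintegral_prod_right' hX]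

namespace ClusterMark

/-- The center of the cluster and its caching devices, seen from the device `j`. -/
noncomputable def info (a : ClusterMark) (j : ℕ) : Plane × Measure Plane :=
  (-(a.2 j).1, ∑ l ∈ Finset.range a.1,
    if l ≠ j ∧ (a.2 l).2.1 = true then Measure.dirac ((a.2 l).1 - (a.2 j).1) else 0)

/-- A measure-valued map is measurable as soon as its evaluations on measurable sets are. -/
lemma measurable_info (j : ℕ) : Measurable fun a : ClusterMark => a.info j := by
  refine Measurable.prodMk (by fun_prop) (Measure.measurable_of_measurable_coe _ fun s hs => ?_)
  have h1 : ∀ a : ClusterMark, (∑ l ∈ Finset.range a.1,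
      if l ≠ j ∧ (a.2 l).2.1 = true then Measure.dirac ((a.2 l).1 - (a.2 j).1) else 0 :
        Measure Plane) s = ∑' l, if l < a.1 then (if l ≠ j ∧ (a.2 l).2.1 = true then
          s.indicator (fun _ => (1 : ℝ≥0∞)) ((a.2 l).1 - (a.2 j).1) else 0) else 0 := by
    intro a
    rw [Measure.finsetSum_apply, tsum_eq_sum (s := Finset.range a.1)]
    · refine Finset.sum_congr rfl fun l hl => ?_
      rw [if_pos (Finset.mem_range.1 hl)]
      split_ifs
      · rw [Measure.dirac_apply' _ hs]; rfl
      · rfl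
    · intro l hl
      rw [if_neg (by simpa using hl)]
  simp_rw [h1]
  refine Measurable.tsum fun l => Measurable.ite ?_ (Measurable.ite ?_ ?_ measurable_const)
    measurable_const
  · exact measurableSet_lt measurable_const (by fun_prop)
  · refine (MeasurableSet.const _).inter ?_
    exact (by fun_prop : Measurable fun a : ClusterMark => (a.2 l).2.1) (measurableSet_singleton true)
  · exact (measurable_const.indicator hs).comp (by fun_prop)

end ClusterMark

namespace ClusterNetwork

variable {Ω : Type*}

/-- The marks of the cluster `k`, with the fading coefficients to the receiver `p`. -/
def mark (𝒩 : ClusterNetwork Ω) (p : ℕ × ℕ) (k : ℕ) (ω : Ω) : ClusterMark :=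
  (𝒩.size k ω, fun l => (𝒩.disp (k, l) ω, 𝒩.cached (k, l) ω, 𝒩.fading (p, (k, l)) ω))

/-- The information carried by the representative cluster. -/
noncomputable def info (𝒩 : ClusterNetwork Ω) (w : Ω × (ℕ × ℕ)) : Plane × Measure Plane :=
  (𝒩.repCenter w, 𝒩.catering w)

lemma info_eq (𝒩 : ClusterNetwork Ω) (ω : Ω) (i j : ℕ) :
    𝒩.info (ω, (i, j)) = (𝒩.mark (i, j) i ω).info j := by
  refine Prod.ext ?_ ?_
  · simp [info, repCenter, loc, ClusterMark.info, mark]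
  · simp only [info, catering, ClusterMark.info]
    refine Finset.sum_congr rfl fun l _ => ?_
    simp [loc, mark]
    rfl

lemma interference_eq (𝒩 : ClusterNetwork Ω) (α γ : ℝ) (ω : Ω) (i j : ℕ) :
    𝒩.interference α γ (ω, (i, j)) = ∑' k, if k = i then 0 else
      (𝒩.mark (i, j) k ω).power α γ
        (𝒩.parent k ω - 𝒩.parent i ω - ((𝒩.mark (i, j) i ω).2 j).1) := by
  refine tsum_congr fun k => ?_
  by_cases h : k = i
  · simp [h]
  · simp only [h, if_false]
    refine Finset.sum_congr rfl fun l _ => ?_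
    simp only [mark, loc]
    congr 4
    abel

variable [MeasurableSpace Ω]

namespace IsThomas

variable {P : Measure Ω} {lam nbar : ℝ≥0} {σ c : ℝ}
  {𝒩 : ClusterNetwork Ω}

lemma isProbabilityMeasure_planarGaussian [IsProbabilityMeasure P] (h : 𝒩.IsThomas P lam nbar σ c) :
    IsProbabilityMeasure (planarGaussian σ) := by
  rw [← h.law_disp (0, 0)]
  exact Measure.isProbabilityMeasure_map (h.measurable_disp _).aemeasurable

lemma isProbabilityMeasure_map_cached [IsProbabilityMeasure P] (h : 𝒩.IsThomas P lam nbar σ c) (q : ℕ × ℕ) :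
    IsProbabilityMeasure (P.map (𝒩.cached q)) :=
  Measure.isProbabilityMeasure_map (h.measurable_cached _).aemeasurable

/-- A probability law on `Bool` is determined by its mass at `true`. -/
lemma map_cached [IsProbabilityMeasure P] (h : 𝒩.IsThomas P lam nbar σ c) (q : ℕ × ℕ) :
    P.map (𝒩.cached q) = P.map (𝒩.cached (0, 0)) := by
  have := h.isProbabilityMeasure_map_cached q
  have := h.isProbabilityMeasure_map_cached (0, 0)
  have h1 : ∀ q, P.map (𝒩.cached q) {true} = ENNReal.ofReal c := fun q => by
    rw [Measure.map_apply (h.measurable_cached q) (measurableSet_singleton _), ← h.law_cached q]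
    rfl
  have h2 : ∀ q, P.map (𝒩.cached q) {false} = 1 - ENNReal.ofReal c := fun q => by
    have := h.isProbabilityMeasure_map_cached q
    rw [← h1 q, ← prob_compl_eq_one_sub (measurableSet_singleton _)]
    congr 1
    ext b; cases b <;> simp
  refine Measure.ext_of_singleton fun b => ?_
  cases b
  · rw [h2, h2]
  · rw [h1, h1]

lemma measurable_mark (h : 𝒩.IsThomas P lam nbar σ c) (p : ℕ × ℕ) (k : ℕ) :
    Measurable (𝒩.mark p k) :=
  (h.measurable_size k).prodMk (measurable_pi_iff.2 fun _ =>
    (h.measurable_disp _).prodMk ((h.measurable_cached _).prodMk (h.measurable_fading _)))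

/-- Toward a fixed receiver p, the marks are i.i.d. over clusters, with a law independent of p. The
four mark families are joined one at a time from the nested independence hypotheses. -/
lemma map_mark [IsProbabilityMeasure P] (h : 𝒩.IsThomas P lam nbar σ c) (p : ℕ × ℕ) :
    P.map (fun ω k => 𝒩.mark p k ω) =
      Measure.infinitePi fun _ => markLaw nbar σ (P.map (𝒩.cached (0, 0))) := by
  have := h.isProbabilityMeasure_planarGaussian
  have := h.isProbabilityMeasure_map_cached (0, 0)
  set β := P.map (𝒩.cached (0, 0)) with hβ
  set ρ := (planarGaussian σ).prod (β.prod complexGaussian) with hρ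
  have hmD := h.measurable_disp
  have hmC := h.measurable_cached
  have hmF : ∀ q, Measurable (𝒩.fading (p, q)) := fun q => h.measurable_fading _
  have hCF : IndepFun (fun ω q => 𝒩.cached q ω) (fun ω q => 𝒩.fading (p, q) ω) P :=
    h.indep_cached.comp measurable_id
      (ψ := fun (f : (ℕ × ℕ) × (ℕ × ℕ) → ℂ) q => f (p, q)) (by fun_prop)
  have hiCF : iIndepFun (fun q ω => (𝒩.cached q ω, 𝒩.fading (p, q) ω)) P :=
    iIndepFun_prodMk hmC hmF h.iIndep_cached
      (h.iIndep_fading.precomp (g := fun q => (p, q)) (Prod.mk_right_injective p)) hCF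
  have hlCF : ∀ q, P.map (fun ω => (𝒩.cached q ω, 𝒩.fading (p, q) ω)) =
      β.prod complexGaussian := fun q => by
    have hi : IndepFun (𝒩.cached q) (𝒩.fading (p, q)) P :=
      hCF.comp (measurable_pi_apply q) (measurable_pi_apply q)
    rw [(indepFun_iff_map_prod_eq_prod_map_map (hmC q).aemeasurable (hmF q).aemeasurable).1 hi,
      h.map_cached, h.law_fading]
  have hmCF : ∀ q, Measurable fun ω => (𝒩.cached q ω, 𝒩.fading (p, q) ω) := fun q =>
    (hmC q).prodMk (hmF q)
  have hDCF : IndepFun (fun ω q => 𝒩.disp q ω) (fun ω q => (𝒩.cached q ω, 𝒩.fading (p, q) ω)) P :=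
    h.indep_disp.comp measurable_id
      (ψ := fun (f : (ℕ × ℕ → Bool) × ((ℕ × ℕ) × (ℕ × ℕ) → ℂ)) q => (f.1 q, f.2 (p, q)))
      (by fun_prop)
  let R : ℕ × ℕ → Ω → Plane × Bool × ℂ := fun q ω =>
    (𝒩.disp q ω, 𝒩.cached q ω, 𝒩.fading (p, q) ω)
  have hmR : ∀ q, Measurable (R q) := fun q => (hmD q).prodMk (hmCF q)
  have hiR : iIndepFun R P := iIndepFun_prodMk hmD hmCF h.iIndep_disp hiCF hDCF
  have hlR : ∀ q, P.map (R q) = ρ := fun q => by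
    have hi : IndepFun (𝒩.disp q) (fun ω => (𝒩.cached q ω, 𝒩.fading (p, q) ω)) P :=
      hDCF.comp (measurable_pi_apply q) (measurable_pi_apply q)
    rw [(indepFun_iff_map_prod_eq_prod_map_map (hmD q).aemeasurable (hmCF q).aemeasurable).1 hi,
      h.law_disp, hlCF]
  have hmapR : P.map (fun ω q => R q ω) = Measure.infinitePi fun _ : ℕ × ℕ => ρ := by
    rw [(iIndepFun_iff_map_fun_eq_infinitePi_map hmR).1 hiR]
    simp_rw [hlR]
  let R' : ℕ → Ω → ℕ → Plane × Bool × ℂ := fun k ω l => R (k, l) ω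
  have hmR' : ∀ k, Measurable (R' k) := fun k => measurable_pi_iff.2 fun l => hmR _
  have hmapR' : P.map (fun ω k => R' k ω) =
      Measure.infinitePi fun _ : ℕ => Measure.infinitePi fun _ : ℕ => ρ := by
    -- Currying groups the devices (k, l) by cluster: a product over pairs becomes a product of
    -- products.
    rw [← Measure.infinitePi_map_curry (fun _ _ : ℕ => ρ), ← hmapR,
      Measure.map_map (MeasurableEquiv.measurable _) (measurable_pi_iff.2 hmR)]
    rfl
  have hlR' : ∀ k, P.map (R' k) = Measure.infinitePi fun _ : ℕ => ρ := fun k => by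
    rw [← Measure.infinitePi_map_eval (fun _ : ℕ => Measure.infinitePi fun _ : ℕ => ρ) k, ← hmapR',
      Measure.map_map (measurable_pi_apply k) (measurable_pi_iff.2 hmR')]
    rfl
  have hiR' : iIndepFun R' P := by
    rw [iIndepFun_iff_map_fun_eq_infinitePi_map hmR', hmapR']
    simp_rw [hlR']
  have hNR : IndepFun (fun ω k => 𝒩.size k ω) (fun ω k => R' k ω) P :=
    h.indep_size.comp measurable_id
      (ψ := fun (f : (ℕ × ℕ → Plane) × (ℕ × ℕ → Bool) × ((ℕ × ℕ) × (ℕ × ℕ) → ℂ)) k l =>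
        (f.1 (k, l), f.2.1 (k, l), f.2.2 (p, (k, l)))) (by fun_prop)
  have hiM : iIndepFun (fun k => 𝒩.mark p k) P :=
    iIndepFun_prodMk h.measurable_size hmR' h.iIndep_size hiR' hNR
  have hlM : ∀ k, P.map (𝒩.mark p k) = markLaw nbar σ β := fun k => by
    have hi : IndepFun (𝒩.size k) (R' k) P :=
      hNR.comp (measurable_pi_apply k) (measurable_pi_apply k)
    have := (indepFun_iff_map_prod_eq_prod_map_map (h.measurable_size k).aemeasurable
      (hmR' k).aemeasurable).1 hi
    rw [h.law_size, hlR'] at this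
    exact this
  rw [(iIndepFun_iff_map_fun_eq_infinitePi_map fun k => h.measurable_mark p k).1 hiM]
  simp_rw [hlM]

lemma indepFun_parent_mark (h : 𝒩.IsThomas P lam nbar σ c) (p : ℕ × ℕ) :
    IndepFun (fun ω i => 𝒩.parent i ω) (fun ω k => 𝒩.mark p k ω) P :=
  h.indep_parent.comp measurable_id
    (ψ := fun (f : (ℕ → ℕ) × (ℕ × ℕ → Plane) × (ℕ × ℕ → Bool) × ((ℕ × ℕ) × (ℕ × ℕ) → ℂ)) k =>
      ((f.1 k, fun l => (f.2.1 (k, l), f.2.2.1 (k, l), f.2.2.2 (p, (k, l)))) : ClusterMark))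
    (by fun_prop)

end IsThomas

end ClusterNetwork

/-! ### Palm expectations: averaging over the marks and the centers -/

namespace ClusterNetwork

variable {Ω : Type*} [MeasurableSpace Ω]

section

variable {P : Measure Ω} {lam nbar : ℝ≥0} {σ c α γ : ℝ} {𝒩 : ClusterNetwork Ω}

namespace IsThomas

lemma measurable_info (h : 𝒩.IsThomas P lam nbar σ c) : Measurable 𝒩.info := by
  refine measurable_from_prod_countable_left fun p => ?_
  obtain ⟨i, j⟩ := p
  simp_rw [info_eq]
  exact (ClusterMark.measurable_info j).comp (h.measurable_mark _ _)

lemma measurable_interference (h : 𝒩.IsThomas P lam nbar σ c) :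
    Measurable (𝒩.interference α γ) := by
  refine measurable_from_prod_countable_left fun p => ?_
  obtain ⟨i, j⟩ := p
  simp_rw [interference_eq]
  refine Measurable.tsum fun k => ?_
  split_ifs
  · exact measurable_const
  · refine measurable_power (h.measurable_mark _ _) ?_
    exact ((h.parents.measurable k).sub (h.parents.measurable i)).sub
      ((by fun_prop : Measurable fun m : ClusterMark => (m.2 j).1).comp (h.measurable_mark _ _))

/-- Mecke's formula for the parent process of a Thomas process, seen from a device displaced by
`d` from its cluster center. -/
lemma lintegral_parent [IsProbabilityMeasure P] (h : 𝒩.IsThomas P lam nbar σ c) (hγ : 0 < γ)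
    (hα : 0 < α) (t : ℝ≥0) (d : Plane) {B : Set Plane} (hB : MeasurableSet B)
    (hB1 : volume B ≠ ∞) :
    ∫⁻ ω, ∑' i, B.indicator (fun _ => 1) (𝒩.parent i ω + d) *
        expNeg (∑' k, if k = i then 0 else
          nbar * clusterLoss α γ σ t (𝒩.parent k ω - 𝒩.parent i ω - d)) ∂P =
      lam * volume B * networkLaplace lam nbar α γ σ t := by
  have := h.isProbabilityMeasure_planarGaussian
  have hcl : ∀ z, clusterLoss α γ σ t z ≠ ∞ := fun z =>
    ne_top_of_le_ne_top ENNReal.one_ne_top (clusterLoss_le_one hγ z)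
  -- The fixed displacement d is absorbed into the test function, and translation invariance removes
  -- it at the end.
  let u : Plane → ℝ≥0 := fun z => nbar * (clusterLoss α γ σ t (z - d)).toNNReal
  have hu : ∀ z, (u z : ℝ≥0∞) = nbar * clusterLoss α γ σ t (z - d) := fun z => by
    simp only [u]
    rw [ENNReal.coe_mul, ENNReal.coe_toNNReal (hcl _)]
  have huc : Continuous u := by
    refine continuous_const.mul ?_
    refine ENNReal.continuousOn_toNNReal.comp_continuous
      ((continuous_clusterLoss hγ hα).comp (by fun_prop)) fun z => hcl _
  have huC : ∀ z, u z ≤ nbar := fun z => by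
    refine mul_le_of_le_one_right' ?_
    rw [← ENNReal.coe_le_coe, ENNReal.coe_toNNReal (hcl _)]
    exact clusterLoss_le_one hγ _
  have hf : Measurable fun x : Plane => B.indicator (fun _ => (1 : ℝ≥0∞)) (x + d) :=
    (measurable_const.indicator hB).comp (by fun_prop)
  have hfi : ∫⁻ x, B.indicator (fun _ => (1 : ℝ≥0∞)) (x + d) ∂(lam • (volume : Measure Plane)) =
      lam * volume B := by
    rw [lintegral_smul_measure, lintegral_add_right_eq_self (fun x => B.indicator (fun _ => 1) x),
      lintegral_indicator_const hB, one_mul]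
    rfl
  have hmecke := h.parents.lintegral_tsum_mul_expNeg_tsum_sub hf
    (by rw [hfi]; exact ENNReal.mul_ne_top ENNReal.coe_ne_top hB1) huc huC
  rw [hfi] at hmecke
  simp_rw [hu] at hmecke
  rw [hmecke, networkLaplace, lintegral_smul_measure, lintegral_smul_measure,
    lintegral_sub_right_eq_self (fun z => 1 - expNeg (nbar * clusterLoss α γ σ t z))]

end IsThomas

/-- The contribution of the device `j` of the cluster `i` to the Palm expectation, in terms of the
parents and of the marks. -/
noncomputable def palmIntegrand (α γ : ℝ) (B : Set Plane) (H : Plane × Measure Plane → ℝ≥0∞)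
    (τ : Plane × Measure Plane → ℝ≥0) (i j : ℕ) (x : ℕ → Plane) (m : ℕ → ClusterMark) : ℝ≥0∞ :=
  (if j < (m i).1 then H ((m i).info j) else 0) *
    (B.indicator (fun _ => 1) (x i + ((m i).2 j).1) *
      expNeg (∑' k, if k = i then 0 else
        τ ((m i).info j) * (m k).power α γ (x k - x i - ((m i).2 j).1)))

section

variable {B : Set Plane} {H : Plane × Measure Plane → ℝ≥0∞} {τ : Plane × Measure Plane → ℝ≥0}

lemma measurable_weight (hH : Measurable H) (j : ℕ) :
    Measurable fun a : ClusterMark => if j < a.1 then H (a.info j) else 0 :=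
  Measurable.ite (measurableSet_lt measurable_const (by fun_prop))
    (hH.comp (ClusterMark.measurable_info j)) measurable_const

lemma measurable_palmIntegrand (hB : MeasurableSet B) (hH : Measurable H) (hτ : Measurable τ)
    (i j : ℕ) : Measurable fun p : (ℕ → Plane) × (ℕ → ClusterMark) =>
      palmIntegrand α γ B H τ i j p.1 p.2 := by
  refine Measurable.mul ?_ (Measurable.mul ?_ (measurable_expNeg.comp ?_))
  · exact (measurable_weight hH j).comp (by fun_prop)
  · exact (measurable_const.indicator hB).comp (by fun_prop)
  · refine Measurable.tsum fun k => ?_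
    split_ifs
    · exact measurable_const
    · refine Measurable.mul (Measurable.coe_nnreal_ennreal ?_) ?_
      · exact (hτ.comp (ClusterMark.measurable_info j)).comp (by fun_prop)
      · fun_prop

/-- With mark i frozen, the weight, τ and the displacement are constants, and the other clusters
contribute independent factors. -/
lemma lintegral_palmIntegrand_update {β : Measure Bool} [IsProbabilityMeasure (planarGaussian σ)]
    [IsProbabilityMeasure β] (hγ : 0 < γ) (i j : ℕ) (x : ℕ → Plane) (a : ClusterMark) :
    ∫⁻ m, palmIntegrand α γ B H τ i j x (Function.update m i a)
        ∂(Measure.infinitePi fun _ => markLaw nbar σ β) =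
      (if j < a.1 then H (a.info j) else 0) * (B.indicator (fun _ => 1) (x i + (a.2 j).1) *
        expNeg (∑' k, if k = i then 0 else
          nbar * clusterLoss α γ σ (τ (a.info j)) (x k - x i - (a.2 j).1))) := by
  have h1 : ∀ m : ℕ → ClusterMark, palmIntegrand α γ B H τ i j x (Function.update m i a) =
      (if j < a.1 then H (a.info j) else 0) * (B.indicator (fun _ => 1) (x i + (a.2 j).1)) *
        expNeg (∑' k, (if k = i then fun _ => 0 else fun b : ClusterMark =>
          τ (a.info j) * b.power α γ (x k - x i - (a.2 j).1)) (m k)) := by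
    intro m
    rw [palmIntegrand, Function.update_self, mul_assoc]
    congr 4
    ext k
    by_cases hk : k = i
    · simp [hk]
    · simp [hk]
  have hm : ∀ k : ℕ, Measurable (if k = i then fun _ => 0 else fun b : ClusterMark =>
      (τ (a.info j) : ℝ≥0∞) * b.power α γ (x k - x i - (a.2 j).1)) := fun k => by
    split_ifs
    · exact measurable_const
    · fun_prop
  simp_rw [h1]
  rw [lintegral_const_mul, lintegral_infinitePi_expNeg_tsum _ hm (a := fun k => if k = i then 0 else
    nbar * clusterLoss α γ σ (τ (a.info j)) (x k - x i - (a.2 j).1)), mul_assoc]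
  · intro k
    split_ifs
    · simp
    · exact lintegral_expNeg_power hγ _
  · exact measurable_expNeg.comp (Measurable.tsum fun k => (hm k).comp (measurable_pi_apply k))

namespace IsThomas

/-- The remote marks are averaged first, then the centers for a frozen own mark a, then a itself.
The sum over i is kept whole because Mecke's formula concerns it, and the factor λ|B| it yields does
not depend on a. -/
lemma lintegral_palmIntegrand [IsProbabilityMeasure P] (h : 𝒩.IsThomas P lam nbar σ c)
    (hγ : 0 < γ) (hα : 0 < α) (hB : MeasurableSet B) (hB1 : volume B ≠ ∞) (hH : Measurable H)
    (hτ : Measurable τ) (j : ℕ) :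
    ∑' i, ∫⁻ ω, palmIntegrand α γ B H τ i j (fun k => 𝒩.parent k ω)
        (fun k => 𝒩.mark (i, j) k ω) ∂P =
      lam * volume B * ∫⁻ a, (if j < a.1 then H (a.info j) else 0) *
        networkLaplace lam nbar α γ σ (τ (a.info j))
          ∂(markLaw nbar σ (P.map (𝒩.cached (0, 0)))) := by
  have := h.isProbabilityMeasure_planarGaussian
  have := h.isProbabilityMeasure_map_cached (0, 0)
  set Q := markLaw nbar σ (P.map (𝒩.cached (0, 0)))
  have hmX : Measurable fun ω i => 𝒩.parent i ω := measurable_pi_iff.2 h.parents.measurable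
  have hmτ : Measurable fun a : ClusterMark => τ (a.info j) :=
    hτ.comp (ClusterMark.measurable_info j)
  let K : ℕ → Ω × ClusterMark → ℝ≥0∞ := fun i p =>
    B.indicator (fun _ => 1) (𝒩.parent i p.1 + (p.2.2 j).1) *
      expNeg (∑' k, if k = i then 0 else
        nbar * clusterLoss α γ σ (τ (p.2.info j))
          (𝒩.parent k p.1 - 𝒩.parent i p.1 - (p.2.2 j).1))
  have hmP : ∀ i, Measurable fun p : Ω × ClusterMark => 𝒩.parent i p.1 := fun i =>
    (h.parents.measurable i).comp measurable_fst
  have hmd : Measurable fun p : Ω × ClusterMark => (p.2.2 j).1 := by fun_prop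
  have hK : ∀ i, Measurable (K i) := by
    intro i
    refine Measurable.mul ?_ (measurable_expNeg.comp (Measurable.tsum fun k => ?_))
    · exact (measurable_const.indicator hB).comp ((hmP i).add hmd)
    · split_ifs
      · exact measurable_const
      · exact (Measurable.clusterLoss (hmτ.comp measurable_snd)
          (((hmP k).sub (hmP i)).sub hmd)).const_mul _
  have hW : Measurable fun a : ClusterMark => if j < a.1 then H (a.info j) else 0 :=
    measurable_weight hH j
  have h1 : ∀ i, ∫⁻ ω, palmIntegrand α γ B H τ i j (fun k => 𝒩.parent k ω)
        (fun k => 𝒩.mark (i, j) k ω) ∂P =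
      ∫⁻ ω, ∫⁻ a, (if j < a.1 then H (a.info j) else 0) * K i (ω, a) ∂Q ∂P := by
    intro i
    have hF := measurable_palmIntegrand (α := α) (γ := γ) hB hH hτ i j
    rw [IndepFun.lintegral_comp_prodMk (h.indepFun_parent_mark (i, j)) hmX
      (measurable_pi_iff.2 fun k => h.measurable_mark (i, j) k) hF, h.map_mark]
    refine lintegral_congr fun ω => ?_
    have hFω : Measurable (palmIntegrand α γ B H τ i j fun k => 𝒩.parent k ω) := by
      have hpair : Measurable fun m : ℕ → ClusterMark => ((fun k => 𝒩.parent k ω), m) :=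
        measurable_prodMk_left
      have := hF.comp hpair
      exact this
    have hupd := fun a => lintegral_palmIntegrand_update (α := α) (nbar := nbar) (σ := σ)
      (β := P.map (𝒩.cached (0, 0))) (B := B) (H := H) (τ := τ) hγ i j (fun k => 𝒩.parent k ω) a
    have hres := lintegral_infinitePi_update (E := fun _ : ℕ => ClusterMark)
      (fun _ => markLaw nbar σ (P.map (𝒩.cached (0, 0)))) i hFω
    simp only [hupd] at hres
    exact hres
  have hmWK : ∀ i, Measurable fun p : Ω × ClusterMark =>
      (if j < p.2.1 then H (p.2.info j) else 0) * K i p := fun i =>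
    (hW.comp measurable_snd).mul (hK i)
  simp_rw [h1]
  have h2 : ∀ i, ∫⁻ ω, ∫⁻ a, (if j < a.1 then H (a.info j) else 0) * K i (ω, a) ∂Q ∂P =
      ∫⁻ a, (if j < a.1 then H (a.info j) else 0) * ∫⁻ ω, K i (ω, a) ∂P ∂Q := by
    intro i
    rw [lintegral_lintegral_swap (hmWK i).aemeasurable]
    exact lintegral_congr fun a => lintegral_const_mul _ ((hK i).comp measurable_prodMk_right)
  simp_rw [h2]
  have hmWI : ∀ i, AEMeasurable (fun a : ClusterMark =>
      (if j < a.1 then H (a.info j) else 0) * ∫⁻ ω, K i (ω, a) ∂P) Q := fun i =>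
    (hW.mul (hK i).lintegral_prod_left').aemeasurable
  rw [← lintegral_tsum hmWI, ← lintegral_const_mul]
  · refine lintegral_congr fun a => ?_
    have hmKa : ∀ i, AEMeasurable (fun ω => K i (ω, a)) P := fun i =>
      ((hK i).comp measurable_prodMk_right).aemeasurable
    rw [ENNReal.tsum_mul_left, ← lintegral_tsum hmKa]
    have := h.lintegral_parent hγ hα (τ (a.info j)) (a.2 j).1 hB hB1
    simp only [K]
    rw [this]
    ring
  · exact hW.mul (measurable_networkLaplace.comp hmτ)

/-- The Palm expectation becomes an integral over the mark of a single cluster, in which the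
interference appears only through `networkLaplace`. -/
lemma lintegral_typicalDevice [IsProbabilityMeasure P] (h : 𝒩.IsThomas P lam nbar σ c)
    (hγ : 0 < γ) (hα : 0 < α) (hB : MeasurableSet B) (hB1 : volume B ≠ ∞) (hH : Measurable H)
    (hτ : Measurable τ) :
    ∫⁻ w, H (𝒩.info w) * expNeg (τ (𝒩.info w) * 𝒩.interference α γ w)
        ∂(𝒩.typicalDevice P lam nbar B) =
      ((lam : ℝ≥0∞) * nbar * volume B)⁻¹ * (lam * volume B * ∑' j,
        ∫⁻ a, (if j < a.1 then H (a.info j) else 0) *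
          networkLaplace lam nbar α γ σ (τ (a.info j))
            ∂(markLaw nbar σ (P.map (𝒩.cached (0, 0))))) := by
  have hm : Measurable fun w => H (𝒩.info w) * expNeg (τ (𝒩.info w) * 𝒩.interference α γ w) := by
    have := h.measurable_info
    have := h.measurable_interference (α := α) (γ := γ)
    fun_prop
  rw [typicalDevice, lintegral_smul_measure, lintegral_sum_measure, smul_eq_mul]
  congr 1
  rw [← ENNReal.tsum_mul_left]
  simp_rw [← h.lintegral_palmIntegrand hγ hα hB hB1 hH hτ]
  rw [ENNReal.tsum_comm, ENNReal.summable.tsum_prod' fun _ => ENNReal.summable]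
  refine tsum_congr fun i => tsum_congr fun j => ?_
  have hmloc : Measurable fun ω => 𝒩.loc (i, j) ω :=
    (h.parents.measurable i).add (h.measurable_disp _)
  have hS : MeasurableSet {ω | j < 𝒩.size i ω ∧ 𝒩.loc (i, j) ω ∈ B} :=
    (measurableSet_lt measurable_const (h.measurable_size i)).inter (hmloc hB)
  rw [lintegral_map hm measurable_prodMk_right, ← lintegral_indicator hS]
  refine lintegral_congr fun ω => ?_
  have hI : τ (𝒩.info (ω, (i, j))) * 𝒩.interference α γ (ω, (i, j)) =
      ∑' k, if k = i then 0 else τ (𝒩.info (ω, (i, j))) * (𝒩.mark (i, j) k ω).power α γ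
        (𝒩.parent k ω - 𝒩.parent i ω - ((𝒩.mark (i, j) i ω).2 j).1) := by
    rw [interference_eq, ← ENNReal.tsum_mul_left]
    simp only [mul_ite, mul_zero]
  rw [palmIntegrand, ← info_eq, ← hI]
  have hsz : (𝒩.mark (i, j) i ω).1 = 𝒩.size i ω := rfl
  have hloc : 𝒩.parent i ω + ((𝒩.mark (i, j) i ω).2 j).1 = 𝒩.loc (i, j) ω := rfl
  rw [hsz, hloc]
  by_cases h1 : j < 𝒩.size i ω
  · by_cases h2 : 𝒩.loc (i, j) ω ∈ B
    · rw [indicator_of_mem (show ω ∈ {ω | j < 𝒩.size i ω ∧ 𝒩.loc (i, j) ω ∈ B} from ⟨h1, h2⟩),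
        indicator_of_mem h2, if_pos h1, one_mul]
    · rw [indicator_of_notMem (fun hω => h2 hω.2), indicator_of_notMem h2, zero_mul, mul_zero]
  · rw [indicator_of_notMem (fun hω => h1 hω.1), if_neg h1, zero_mul]

end IsThomas

end

end

end ClusterNetwork

/-! ### Normalization, finiteness and conditional Laplace transform -/

lemma networkLaplace_zero (lam nbar : ℝ≥0) (α γ σ : ℝ) : networkLaplace lam nbar α γ σ 0 = 1 := by
  simp [networkLaplace, clusterLoss, attenuation]

lemma tsum_ite_lt (n : ℕ) : ∑' j : ℕ, (if j < n then 1 else 0 : ℝ≥0∞) = n := by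
  rw [tsum_eq_sum (s := Finset.range n) fun j hj => if_neg (by simpa using hj),
    Finset.sum_congr rfl fun j hj => if_pos (Finset.mem_range.1 hj)]
  simp

/-- The mean cluster size. -/
lemma tsum_lintegral_lt_size (nbar : ℝ≥0) (σ : ℝ) (β : Measure Bool)
    [IsProbabilityMeasure (planarGaussian σ)] [IsProbabilityMeasure β] :
    ∑' j : ℕ, ∫⁻ a : ClusterMark, (if j < a.1 then 1 else 0) ∂(markLaw nbar σ β) = nbar := by
  have hm : ∀ j : ℕ, Measurable fun a : ClusterMark => (if j < a.1 then 1 else 0 : ℝ≥0∞) :=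
    fun j => Measurable.ite (measurableSet_lt measurable_const (by fun_prop)) measurable_const
      measurable_const
  rw [← lintegral_tsum fun j => (hm j).aemeasurable]
  simp_rw [tsum_ite_lt]
  have hcast : Measurable fun a : ClusterMark => (a.1 : ℝ≥0∞) :=
    (measurable_of_countable fun n : ℕ => (n : ℝ≥0∞)).comp measurable_fst
  rw [markLaw, lintegral_prod _ hcast.aemeasurable]
  simp only [lintegral_const, measure_univ, mul_one]
  exact lintegral_natCast_poissonMeasure nbar

namespace ClusterNetwork

namespace IsThomas

variable {Ω : Type*} [MeasurableSpace Ω] {P : Measure Ω} [IsProbabilityMeasure P]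
  {lam nbar : ℝ≥0} {σ c α γ : ℝ} {𝒩 : ClusterNetwork Ω} {B : Set Plane}

lemma isProbabilityMeasure_typicalDevice (h : 𝒩.IsThomas P lam nbar σ c) (hlam : 0 < lam)
    (hnbar : 0 < nbar) (hB : MeasurableSet B) (hB0 : volume B ≠ 0) (hB1 : volume B ≠ ∞) :
    IsProbabilityMeasure (𝒩.typicalDevice P lam nbar B) := by
  have := h.isProbabilityMeasure_planarGaussian
  have := h.isProbabilityMeasure_map_cached (0, 0)
  refine ⟨?_⟩
  -- With τ = 0 the interference drops out, so the exponents `α` and `γ` are arbitrary; the sum over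
  -- j gives the mean cluster size n̄.
  have h1 := h.lintegral_typicalDevice (α := 1) (γ := 1) one_pos one_pos hB hB1
    (H := fun _ => 1) (τ := fun _ => 0) measurable_const measurable_const
  simp only [ENNReal.coe_zero, zero_mul, expNeg_zero, mul_one, networkLaplace_zero,
    lintegral_one, tsum_lintegral_lt_size] at h1
  rw [h1, mul_right_comm]
  refine ENNReal.inv_mul_cancel ?_ ?_
  · have h1 : (lam : ℝ≥0∞) ≠ 0 := by simpa using hlam.ne'
    have h2 : (nbar : ℝ≥0∞) ≠ 0 := by simpa using hnbar.ne'
    exact mul_ne_zero (mul_ne_zero h1 hB0) h2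
  · exact ENNReal.mul_ne_top (ENNReal.mul_ne_top ENNReal.coe_ne_top hB1) ENNReal.coe_ne_top

/-- The Laplace transform of the interference does not depend on the representative cluster. -/
lemma lintegral_mul_expNeg_interference (h : 𝒩.IsThomas P lam nbar σ c) (hγ : 0 < γ)
    (hα : 0 < α) (hB : MeasurableSet B) (hB1 : volume B ≠ ∞)
    {H : Plane × Measure Plane → ℝ≥0∞} {τ : Plane × Measure Plane → ℝ≥0} (hH : Measurable H)
    (hτ : Measurable τ) :
    ∫⁻ w, H (𝒩.info w) * expNeg (τ (𝒩.info w) * 𝒩.interference α γ w)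
        ∂(𝒩.typicalDevice P lam nbar B) =
      ∫⁻ w, H (𝒩.info w) * networkLaplace lam nbar α γ σ (τ (𝒩.info w))
        ∂(𝒩.typicalDevice P lam nbar B) := by
  have := h.isProbabilityMeasure_planarGaussian
  -- The Palm formula with weight H·L(τ) and zero argument has the same right-hand side as with
  -- weight H and argument τ.
  have h1 := h.lintegral_typicalDevice hγ hα hB hB1
    (H := fun x => H x * networkLaplace lam nbar α γ σ (τ x)) (τ := fun _ => 0)
    (hH.mul (measurable_networkLaplace.comp hτ)) measurable_const
  simp only [ENNReal.coe_zero, zero_mul, expNeg_zero, mul_one, networkLaplace_zero] at h1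
  rw [h1, h.lintegral_typicalDevice hγ hα hB hB1 hH hτ]
  simp only [ite_mul, zero_mul]

/-- Since e^{-∞} = 0, L(t) = E[e^{-tI}] ≤ P(I < ∞) for t > 0; letting t → 0 makes the left side tend
to 1. -/
lemma ae_interference_lt_top (h : 𝒩.IsThomas P lam nbar σ c) (hlam : 0 < lam)
    (hnbar : 0 < nbar) (hγ : 0 < γ) (hα : 2 < α) (hB : MeasurableSet B) (hB0 : volume B ≠ 0)
    (hB1 : volume B ≠ ∞) :
    ∀ᵐ w ∂(𝒩.typicalDevice P lam nbar B), 𝒩.interference α γ w < ∞ := by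
  have := h.isProbabilityMeasure_planarGaussian
  have := h.isProbabilityMeasure_typicalDevice hlam hnbar hB hB0 hB1
  set μ := 𝒩.typicalDevice P lam nbar B
  have hmI := h.measurable_interference (α := α) (γ := γ)
  have hS : MeasurableSet {w | 𝒩.interference α γ w < ∞} := measurableSet_lt hmI measurable_const
  have hle : ∀ n : ℕ, networkLaplace lam nbar α γ σ (1 / (n + 1)) ≤
      μ {w | 𝒩.interference α γ w < ∞} := by
    intro n
    have h1 := h.lintegral_mul_expNeg_interference hγ (by linarith) hB hB1
      (H := fun _ => 1) (τ := fun _ => 1 / (n + 1 : ℝ≥0)) (α := α) measurable_const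
      measurable_const
    simp only [one_mul, lintegral_const] at h1
    rw [measure_univ, mul_one] at h1
    rw [← h1, ← lintegral_indicator_one hS]
    refine lintegral_mono fun w => ?_
    by_cases hw : 𝒩.interference α γ w < ∞
    · rw [indicator_of_mem (show w ∈ {w | 𝒩.interference α γ w < ∞} from hw)]
      exact expNeg_le_one _
    · rw [not_lt, top_le_iff] at hw
      have hn : ((1 / (n + 1 : ℝ≥0) : ℝ≥0) : ℝ≥0∞) ≠ 0 := by
        rw [ENNReal.coe_ne_zero]; positivity
      simp only [hw, ENNReal.mul_top hn, expNeg_top]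
      exact zero_le
  have h1 : μ {w | 𝒩.interference α γ w < ∞} = 1 :=
    le_antisymm prob_le_one (le_of_tendsto' (tendsto_networkLaplace hγ hα) hle)
  exact (mem_ae_iff_prob_eq_one hS).2 h1

/-- The conditional Laplace transform of the interference, at an argument determined by the
representative cluster. -/
lemma condExp_interference (h : 𝒩.IsThomas P lam nbar σ c) (hlam : 0 < lam)
    (hnbar : 0 < nbar) (hσ : 0 < σ) (hγ : 0 < γ) (hα : 2 < α) (hB : MeasurableSet B)
    (hB0 : volume B ≠ 0) (hB1 : volume B ≠ ∞) {τ : Plane × Measure Plane → ℝ≥0}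
    (hτ : Measurable τ) :
    (𝒩.typicalDevice P lam nbar B)[fun w =>
        Real.exp (-(τ (𝒩.info w) : ℝ) * (𝒩.interference α γ w).toReal) | 𝒩.cateringInfo]
      =ᵐ[𝒩.typicalDevice P lam nbar B] fun w =>
        laplaceFormula lam nbar α γ σ (τ (𝒩.info w)) := by
  have := h.isProbabilityMeasure_planarGaussian
  have := h.isProbabilityMeasure_typicalDevice hlam hnbar hB hB0 hB1
  set μ := 𝒩.typicalDevice P lam nbar B
  have hmi := h.measurable_info
  have hmI := h.measurable_interference (α := α) (γ := γ)
  have hm : 𝒩.cateringInfo ≤ (inferInstance : MeasurableSpace (Ω × (ℕ × ℕ))) := hmi.comap_le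
  have hL0 : ∀ t : ℝ≥0, 0 ≤ laplaceFormula lam nbar α γ σ t := fun t => (Real.exp_pos _).le
  have hlap : ∀ t : ℝ≥0, laplaceFormula lam nbar α γ σ t =
      (networkLaplace lam nbar α γ σ t).toReal := fun t => by
    rw [networkLaplace_eq hγ hσ hα, ENNReal.toReal_ofReal (hL0 t)]
  have hL1 : ∀ t : ℝ≥0, laplaceFormula lam nbar α γ σ t ≤ 1 := fun t => by
    rw [hlap]
    exact ENNReal.toReal_le_of_le_ofReal zero_le_one
      ((expNeg_le_one _).trans_eq ENNReal.ofReal_one.symm)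
  have hgm : Measurable fun x : Plane × Measure Plane => laplaceFormula lam nbar α γ σ (τ x) := by
    simp_rw [hlap]
    exact (measurable_networkLaplace.comp hτ).ennreal_toReal
  have hfm : Measurable fun w =>
      Real.exp (-(τ (𝒩.info w) : ℝ) * (𝒩.interference α γ w).toReal) := by fun_prop
  have hf0 : ∀ w, -(τ (𝒩.info w) : ℝ) * (𝒩.interference α γ w).toReal ≤ 0 := fun w => by
    rw [neg_mul, neg_nonpos]; positivity
  have hfint : Integrable (fun w =>
      Real.exp (-(τ (𝒩.info w) : ℝ) * (𝒩.interference α γ w).toReal)) μ := by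
    refine (integrable_const (1 : ℝ)).mono' hfm.aestronglyMeasurable
      (Eventually.of_forall fun w => ?_)
    rw [Real.norm_eq_abs, abs_of_pos (Real.exp_pos _), Real.exp_le_one_iff]
    exact hf0 w
  have hgint : Integrable (fun w => laplaceFormula lam nbar α γ σ (τ (𝒩.info w))) μ := by
    refine (integrable_const (1 : ℝ)).mono' (hgm.comp hmi).aestronglyMeasurable
      (Eventually.of_forall fun w => ?_)
    rw [Real.norm_eq_abs, abs_of_nonneg (hL0 _)]
    exact hL1 _
  symm
  refine ae_eq_condExp_of_forall_setIntegral_eq hm hfint (fun s _ _ => hgint.integrableOn) ?_ ?_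
  -- An event of the conditioning σ-algebra is a preimage of some E, so the indicator of E serves as
  -- the weight H.
  · rintro _ ⟨E, hE, rfl⟩ _
    have hpre : (fun w => (𝒩.repCenter w, 𝒩.catering w)) ⁻¹' E = 𝒩.info ⁻¹' E := rfl
    rw [hpre, integral_eq_lintegral_of_nonneg_ae (Eventually.of_forall fun w => hL0 _)
      (hgm.comp hmi).aestronglyMeasurable, integral_eq_lintegral_of_nonneg_ae
      (Eventually.of_forall fun w => (Real.exp_pos _).le) hfm.aestronglyMeasurable]
    congr 1
    have h1 := h.lintegral_mul_expNeg_interference hγ (by linarith) hB hB1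
      (H := E.indicator fun _ => 1) (α := α) (measurable_const.indicator hE) hτ
    rw [← lintegral_indicator (hmi hE), ← lintegral_indicator (hmi hE)]
    refine Eq.trans ?_ (h1.symm.trans ?_)
    · refine lintegral_congr fun w => ?_
      by_cases hw : 𝒩.info w ∈ E
      · rw [indicator_of_mem (show w ∈ 𝒩.info ⁻¹' E from hw), indicator_of_mem hw, one_mul,
          networkLaplace_eq hγ hσ hα]
      · rw [indicator_of_notMem (show w ∉ 𝒩.info ⁻¹' E from hw), indicator_of_notMem hw, zero_mul]
    -- `toReal` sends ∞ to 0, so the real exponential is guaranteed to agree with `expNeg` only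
    -- where the interference is finite.
    · refine lintegral_congr_ae ?_
      filter_upwards [h.ae_interference_lt_top hlam hnbar hγ hα hB hB0 hB1] with w hwI
      by_cases hw : 𝒩.info w ∈ E
      · rw [indicator_of_mem (show w ∈ 𝒩.info ⁻¹' E from hw), indicator_of_mem hw, one_mul,
          expNeg_eq (ENNReal.mul_ne_top ENNReal.coe_ne_top hwI.ne), ENNReal.toReal_mul,
          ENNReal.coe_toReal, neg_mul]
      · rw [indicator_of_notMem (show w ∉ 𝒩.info ⁻¹' E from hw), indicator_of_notMem hw, zero_mul]
  · have hinfo : Measurable[𝒩.cateringInfo] 𝒩.info := comap_measurable _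
    exact (hgm.comp hinfo).stronglyMeasurable.aestronglyMeasurable

end IsThomas

end ClusterNetwork

theorem lemma1 {Ω : Type*} [MeasurableSpace Ω] (P : Measure Ω) [IsProbabilityMeasure P]
    (lam nbar : ℝ≥0) (σ c α γ : ℝ)
    (hlam : 0 < lam) (hnbar : 0 < nbar) (hσ : 0 < σ) (hc0 : 0 ≤ c) (hc1 : c ≤ 1)
    (hα : 2 < α) (hγ : 0 < γ)
    (𝒩 : ClusterNetwork Ω) (h𝒩 : 𝒩.IsThomas P lam nbar σ c)
    (B : Set Plane) (hB : MeasurableSet B) (hB0 : volume B ≠ 0) (hB1 : volume B ≠ ∞) :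
    -- the typical device is well defined and its interference is almost surely finite
    IsProbabilityMeasure (𝒩.typicalDevice P lam nbar B) ∧
    (∀ᵐ w ∂(𝒩.typicalDevice P lam nbar B), 𝒩.interference α γ w < ∞) ∧
    -- the integrals in the formula converge
    (∀ t : ℝ, 0 ≤ t →
      (∀ v : ℝ, 0 ≤ v →
        IntegrableOn (fun u => t * γ / (u ^ α + t * γ) * ricePDF u v σ) (Ioi 0)) ∧
      IntegrableOn (fun v => (1 - Real.exp (-nbar * zetaFn α γ σ v t)) * v) (Ioi 0)) ∧
    -- Laplace transform
    (∀ t : ℝ, 0 ≤ t →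
      ∫ w, Real.exp (-t * (𝒩.interference α γ w).toReal) ∂(𝒩.typicalDevice P lam nbar B) =
        laplaceFormula lam nbar α γ σ t) ∧
    -- Laplace transform, conditioned on the transmitters of the representative cluster
    (∀ t : ℝ, 0 ≤ t →
      (𝒩.typicalDevice P lam nbar B)[fun w =>
          Real.exp (-t * (𝒩.interference α γ w).toReal) | 𝒩.cateringInfo]
        =ᵐ[𝒩.typicalDevice P lam nbar B] fun _ => laplaceFormula lam nbar α γ σ t) ∧
    -- the same at the argument determined by the realization of these transmitters
    (∀ θ : ℝ, 0 < θ →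
      ∀ᵐ w ∂(𝒩.typicalDevice P lam nbar B), 0 < 𝒩.servingSum α w →
        ((𝒩.typicalDevice P lam nbar B)[fun w' =>
          Real.exp (-(θ / (γ * 𝒩.servingSum α w')) * (𝒩.interference α γ w').toReal) |
            𝒩.cateringInfo]) w =
          laplaceFormula lam nbar α γ σ (θ / (γ * 𝒩.servingSum α w))) := by

  have := h𝒩.isProbabilityMeasure_planarGaussian
  have hprob := h𝒩.isProbabilityMeasure_typicalDevice hlam hnbar hB hB0 hB1
  have hfin := h𝒩.ae_interference_lt_top hlam hnbar hγ hα hB hB0 hB1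
  have hcond : ∀ t : ℝ, 0 ≤ t →
      (𝒩.typicalDevice P lam nbar B)[fun w =>
          Real.exp (-t * (𝒩.interference α γ w).toReal) | 𝒩.cateringInfo]
        =ᵐ[𝒩.typicalDevice P lam nbar B] fun _ => laplaceFormula lam nbar α γ σ t := by
    intro t ht
    lift t to ℝ≥0 using ht
    exact h𝒩.condExp_interference hlam hnbar hσ hγ hα hB hB0 hB1 (τ := fun _ => t)
      measurable_const
  refine ⟨hprob, hfin, ?_, ?_, hcond, ?_⟩
  · intro t ht
    lift t to ℝ≥0 using ht
    refine ⟨fun v hv => ?_, integrableOn_one_sub_exp_zetaFn hγ hσ hα⟩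
    -- Every v ≥ 0 is the norm of a vector of the plane.
    have := integrableOn_rice (α := α) (t := t) hγ hσ (EuclideanSpace.single 0 v)
    rwa [PiLp.norm_single, Real.norm_of_nonneg hv] at this
  · intro t ht
    have hm : 𝒩.cateringInfo ≤ (inferInstance : MeasurableSpace (Ω × (ℕ × ℕ))) :=
      h𝒩.measurable_info.comap_le
    rw [← integral_condExp hm, integral_congr_ae (hcond t ht)]
    simp
  · intro θ hθ
    -- The argument depends on the outcome only through the catering measure, so it is an admissible
    -- τ.
    let τ : Plane × Measure Plane → ℝ≥0 := fun x =>
      (θ / (γ * (∫⁻ z, ENNReal.ofReal ‖z‖ ^ (-α) ∂x.2).toReal)).toNNReal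
    have hτ : Measurable τ := by
      have h1 : Measurable fun κ : Measure Plane => ∫⁻ z, ENNReal.ofReal ‖z‖ ^ (-α) ∂κ :=
        Measure.measurable_lintegral (by fun_prop)
      have h2 : Measurable fun x : Plane × Measure Plane =>
          ∫⁻ z, ENNReal.ofReal ‖z‖ ^ (-α) ∂x.2 := h1.comp measurable_snd
      fun_prop
    have hτS : ∀ w, (τ (𝒩.info w) : ℝ) = θ / (γ * 𝒩.servingSum α w) := fun w =>
      Real.coe_toNNReal _ (div_nonneg hθ.le (mul_nonneg hγ.le ENNReal.toReal_nonneg))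
    have h1 := h𝒩.condExp_interference hlam hnbar hσ hγ hα hB hB0 hB1 hτ
    simp only [hτS] at h1
    filter_upwards [h1] with w hw _
    exact hw
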